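/- All alphabets $A$ are finite, $A^*$ is the free monoid on $A$, and $\prec$ denotes division (being a homomorphic image of a submonoid). A pseudovariety is a class of finite monoids closed under finite direct products and division. It is decidable if there is an algorithm that decides, given the multiplication table of a finite monoid, whether the monoid belongs to it. $\mathbf J$ is the class of finite $\mathcal J$-trivial monoids ($MsM=MtM$ implies $s=t$). For a homomorphism $\psi:A^*\to N$ let $\tau_\psi:A^*\to(N\times A\times N)^*$ map $a_1\cdots a_n$ to the word whose $i$-th letter is $(\psi(a_1\cdots a_{i-1}),a_i,\psi(a_{i+1}\cdots a_n))$. For classes $\mathbf V,\mathbf W$ of finite monoids and a surjective homomorphism $\phi:A^*\to M$, we have $M\in\mathbf V\mathbin{**}\mathbf W$ if there are homomorphisms $\psi:A^*\to N\in\mathbf W$ and $h:(N\times A\times N)^*\to L\in\mathbf V$ such that $\psi(v)=\psi(w)$ and $h(\tau_\psi(v))=h(\tau_\psi(w))$ imply $\phi(v)=\phi(w)$, for all $v,w\in A^*$; this does not depend on the choice of $A$ and $\phi$. For $\phi:A^*\to M$ and $k\ge 0$ let $\psi_k:A^*\to N_k=A^*/{\sim_k}$ be the quotient map, where $u\sim_k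 v$ if $u$ and $v$ have the same (scattered) subwords of length at most $k$. The kernel category $\ker_k\phi$ has the object set $N_k\times N_k$. An arrow $(n_1,n_2)\to(n_1',n_2')$ is represented by a word $u\in A^*$ with $n_1\psi_k(u)=n_1'$ and $\psi_k(u)n_2'=n_2$; two such words $u,u'$ represent the same arrow if $\phi(vuw)=\phi(vu'w)$ for all $v,w\in A^*$ with $\psi_k(v)=n_1$ and $\psi_k(w)=n_2'$; composition is concatenation of words. The base monoids of $\ker_k\phi$ are the monoids of arrows from an object to itself. **Statement.** 1. If $\mathbf V$ is a decidable pseudovariety of finite monoids, then $\mathbf V\mathbin{**}\mathbf J$ is a decidable pseudovariety of finite monoids. 2. Let $\mathbf V$ be a pseudovariety of finite monoids that contains a nontrivial monoid, let $\phi:A^*\to M$ be a surjective homomorphism onto a finite monoid, and let $K=|M|\cdot(|A|^2+|A|)/2$. Then $M\in\mathbf V\mathbin{**}\mathbf J$ if and only if every base monoid of $\ker_K\phi$ is in $\mathbf V$. 3. There is an algorithm that, given the multiplication table of a finite monoid $M$, computes the finite category $\ker_K\phi$ (its objects, its arrows with source and target, and its composition table, up to isomorphism), where $A=M$, $\phi:M^*\to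 M$ is the homomorphism that extends the identity map of $M$, and $K=|M|\cdot(|M|^2+|M|)/2$. -/

import Mathlib

open CategoryTheory

/-! ### Pseudovarieties of finite monoids -/

/-- A class (property) of monoids. -/
abbrev MonoidClass : Type 1 := (M : Type) → [Monoid M] → Prop

/-- `M` divides `N`: `M` is a homomorphic image of a submonoid of `N`. -/
def MonoidDivides (M N : Type) [Monoid M] [Monoid N] : Prop :=
  ∃ (S : Submonoid N) (f : S →* M), Function.Surjective f

/-- A pseudovariety of finite monoids: a class of finite monoids closed under finite direct products
(the empty product included) and division. -/
structure IsPseudovariety (V : MonoidClass) : Prop where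
  finite : ∀ (M : Type) [Monoid M], V M → Finite M
  prod : ∀ (ι : Type) [Finite ι] (M : ι → Type) [∀ i, Monoid (M i)],
    (∀ i, V (M i)) → V (∀ i, M i)
  division : ∀ (M N : Type) [Monoid M] [Monoid N], V N → MonoidDivides M N → V M

/-- The class `J` of finite `𝒥`-trivial monoids: `M s M = M t M` implies `s = t`. -/
def ClassJ : MonoidClass := fun M _ =>
  Finite M ∧ ∀ s t : M,
    {x : M | ∃ a b : M, x = a * s * b} = {x : M | ∃ a b : M, x = a * t * b} → s = t

/-! ### The two-sided semidirect product of classes -/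

/-- The length-preserving transduction `τ_ψ : A* → (N × A × N)*` sending `a₁⋯aₙ` to the word whose
`i`-th letter is `(ψ(a₁⋯aᵢ₋₁), aᵢ, ψ(aᵢ₊₁⋯aₙ))`. -/
def transduction {A N : Type} [Monoid N] (ψ : FreeMonoid A →* N) (w : FreeMonoid A) :
    FreeMonoid (N × A × N) :=
  FreeMonoid.ofList (List.ofFn fun i : Fin w.toList.length =>
    (ψ (FreeMonoid.ofList (w.toList.take i)), w.toList[i],
      ψ (FreeMonoid.ofList (w.toList.drop (i + 1)))))

/-- There are `ψ : A* → N ∈ W` and `h : (N × A × N)* → K ∈ V` such that `φ` factors through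
`(h ∘ τ_ψ, ψ)`. -/
def FactorsTwoSided (V W : MonoidClass) {A M : Type} [Monoid M] (φ : FreeMonoid A →* M) : Prop :=
  ∃ (N : Type) (_ : Monoid N) (K : Type) (_ : Monoid K)
    (ψ : FreeMonoid A →* N) (h : FreeMonoid (N × A × N) →* K),
    W N ∧ V K ∧
      ∀ v w : FreeMonoid A,
        ψ v = ψ w → h (transduction ψ v) = h (transduction ψ w) → φ v = φ w

/-- The two-sided semidirect product `V ** W`. -/
def TwoSidedProduct (V W : MonoidClass) : MonoidClass := fun M _ =>
  ∃ (A : Type) (_ : Finite A) (φ : FreeMonoid A →* M),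
    Function.Surjective φ ∧ FactorsTwoSided V W φ

/-- Multiply the first components by `n` on the left and the last ones by `n'` on the right. -/
def shiftMap {A N : Type} [Monoid N] (n n' : N) :
    FreeMonoid (N × A × N) →* FreeMonoid (N × A × N) :=
  FreeMonoid.map fun x => (n * x.1, x.2.1, x.2.2 * n')

theorem transduction_mul {A N : Type} [Monoid N] (ψ : FreeMonoid A →* N) (v w : FreeMonoid A) :
    transduction ψ (v * w) =
      shiftMap 1 (ψ w) (transduction ψ v) * shiftMap (ψ v) 1 (transduction ψ w) := by
  apply FreeMonoid.toList.injective
  simp only [transduction, shiftMap, FreeMonoid.toList_mul, FreeMonoid.toList_map, FreeMonoid.toList_ofList, one_mul, mul_one]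
  apply List.ext_getElem
  · simp
  · intro i h1 h2
    simp only [List.getElem_ofFn, List.getElem_append, List.length_map, List.length_ofFn, List.getElem_map]
    simp only [List.length_ofFn, List.length_append] at h1
    split_ifs with h
    · refine Prod.ext ?_ (Prod.ext (List.getElem_append_left h) ?_)
      · simp only; rw [List.take_append_of_le_length h.le]
      · simp only; rw [List.drop_append_of_le_length h, FreeMonoid.ofList_append, map_mul]; rfl
    · refine Prod.ext ?_ (Prod.ext (List.getElem_append_right (not_lt.1 h)) ?_)
      · simp only; rw [List.take_append, List.take_of_length_le (not_lt.1 h), FreeMonoid.ofList_append, map_mul]; rfl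
      · simp only; rw [List.drop_append, List.drop_eq_nil_of_le (by omega), List.nil_append]
        congr 3; omega

theorem shiftMap_shiftMap {A N : Type} [Monoid N] (a b c d : N) (x : FreeMonoid (N × A × N)) :
    shiftMap a b (shiftMap c d x) = shiftMap (a * c) (d * b) x := by
  simp only [shiftMap, FreeMonoid.map_map]
  congr 2; funext x; simp [mul_assoc]

theorem transduction_one {A N : Type} [Monoid N] (ψ : FreeMonoid A →* N) :
    transduction ψ 1 = 1 := rfl

theorem transduction_of {A N : Type} [Monoid N] (ψ : FreeMonoid A →* N) (a : A) :
    transduction ψ (FreeMonoid.of a) = FreeMonoid.of (1, a, 1) := by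
  apply FreeMonoid.toList.injective
  simp [transduction]

theorem FactorsTwoSided.comp {V W : MonoidClass} {A B M : Type} [Monoid M]
    {φ : FreeMonoid A →* M} (hφ : FactorsTwoSided V W φ) (β : FreeMonoid B →* FreeMonoid A) :
    FactorsTwoSided V W (φ.comp β) := by
  obtain ⟨N, _, K, _, ψ, h, hN, hK, H⟩ := hφ
  let h' : FreeMonoid (N × B × N) →* K := FreeMonoid.lift fun x =>
    h (shiftMap x.1 x.2.2 (transduction ψ (β (FreeMonoid.of x.2.1))))
  have key : ∀ (w : FreeMonoid B) (n n' : N),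
      h' (shiftMap n n' (transduction (ψ.comp β) w)) =
        h (shiftMap n n' (transduction ψ (β w))) := by
    intro w
    induction w using FreeMonoid.inductionOn with
    | one => intro n n'; simp [transduction_one]
    | of b => intro n n'; rw [transduction_of]; simp [h', shiftMap]
    | mul x y hx hy =>
      intro n n'
      rw [transduction_mul, map_mul β, transduction_mul]
      simp only [map_mul, shiftMap_shiftMap, MonoidHom.comp_apply, hx, hy]
  have s1 : ∀ {C : Type} (x : FreeMonoid (N × C × N)), shiftMap 1 1 x = x := by
    intro C x; simp only [shiftMap, one_mul, mul_one]; exact DFunLike.congr_fun FreeMonoid.map_id x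
  refine ⟨N, _, K, _, ψ.comp β, h', hN, hK, fun v w h1 h2 => H _ _ h1 ?_⟩
  have := key v 1 1
  have := key w 1 1
  simp_all

/-- Membership in `V ** W` does not depend on the choice of `A` and `φ`. -/
theorem twoSidedProduct_iff (V W : MonoidClass) {B M : Type} [Finite B] [Monoid M]
    (φ : FreeMonoid B →* M) (hφ : Function.Surjective φ) :
    TwoSidedProduct V W M ↔ FactorsTwoSided V W φ := by
  refine ⟨?_, fun h => ⟨B, ‹_›, φ, hφ, h⟩⟩
  rintro ⟨A, _, φ', hs, h⟩
  choose g hg using hs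
  have : φ = φ'.comp (FreeMonoid.lift fun b => g (φ (FreeMonoid.of b))) := by
    apply FreeMonoid.hom_eq; intro b; simp [hg]
  rw [this]; exact h.comp _

/-! ### The kernel category -/

/-- The objects of the kernel category `ker(ψ ∘ φ⁻¹)`: the pairs `(n₁, n₂) ∈ N × N`. -/
@[ext]
structure KernelCat {A M N : Type} [Monoid M] [Monoid N]
    (φ : FreeMonoid A →* M) (ψ : FreeMonoid A →* N) : Type where
  left : N
  right : N

namespace KernelCat

variable {A M N : Type} [Monoid M] [Monoid N] {φ : FreeMonoid A →* M} {ψ : FreeMonoid A →* N}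

/-- The words that represent an arrow from `X` to `Y`. -/
def Rep (X Y : KernelCat φ ψ) : Type :=
  {u : FreeMonoid A // X.left * ψ u = Y.left ∧ ψ u * Y.right = X.right}

/-- The identification of coterminal arrows. -/
def repSetoid (X Y : KernelCat φ ψ) : Setoid (Rep X Y) where
  r u u' := ∀ v w : FreeMonoid A, ψ v = X.left → ψ w = Y.right →
    φ (v * u.1 * w) = φ (v * u'.1 * w)
  iseqv :=
    { refl := fun _ _ _ _ _ => rfl
      symm := fun h v w hv hw => (h v w hv hw).symm
      trans := fun h h' v w hv hw => (h v w hv hw).trans (h' v w hv hw) }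

/-- The arrows of the kernel category. -/
def Arrow (X Y : KernelCat φ ψ) : Type := Quotient (repSetoid X Y)

/-- The empty word represents the identity arrow. -/
def repOne (X : KernelCat φ ψ) : Rep X X := ⟨1, by simp⟩

/-- Concatenation of representatives of consecutive arrows. -/
def repMul {X Y Z : KernelCat φ ψ} (u : Rep X Y) (v : Rep Y Z) : Rep X Z :=
  ⟨u.1 * v.1, by
    rw [map_mul, ← mul_assoc, u.2.1, v.2.1, mul_assoc, v.2.2, u.2.2]
    exact ⟨rfl, rfl⟩⟩

/-- The product of consecutive arrows. -/
def arrowComp {X Y Z : KernelCat φ ψ} : Arrow X Y → Arrow Y Z → Arrow X Z :=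
  Quotient.map₂ repMul (by
    intro u u' hu v v' hv p q hp hq
    have h1 := hu p (v.1 * q) hp (by rw [map_mul, hq, v.2.2])
    have h2 := hv (p * u'.1) q (by rw [map_mul, hp, u'.2.1]) hq
    simp only [repMul, ← mul_assoc] at h1 h2 ⊢
    exact h1.trans h2)

instance : Category.{0, 0} (KernelCat φ ψ) where
  Hom X Y := Arrow X Y
  id X := Quotient.mk _ (repOne X)
  comp f g := arrowComp f g
  id_comp f := by
    induction f using Quotient.inductionOn with
    | h u => exact congrArg (Quotient.mk _) (Subtype.ext (one_mul _))
  comp_id f := by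
    induction f using Quotient.inductionOn with
    | h u => exact congrArg (Quotient.mk _) (Subtype.ext (mul_one _))
  assoc f g h := by
    induction f using Quotient.inductionOn with
    | h u =>
      induction g using Quotient.inductionOn with
      | h v =>
        induction h using Quotient.inductionOn with
        | h w => exact congrArg (Quotient.mk _) (Subtype.ext (mul_assoc _ _ _))

end KernelCat

/-- The base monoid of a category at the object `X`: the arrows from `X` to `X`, where `f * g` is
`f` followed by `g` (Mathlib's `End X` has the opposite multiplication). -/
def BaseMonoid {C : Type} [Category.{0, 0} C] (X : C) : Type := X ⟶ X

instance {C : Type} [Category.{0, 0} C] (X : C) : Monoid (BaseMonoid X) where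
  one := 𝟙 X
  mul f g := CategoryStruct.comp (obj := C) f g
  one_mul f := Category.id_comp (obj := C) f
  mul_one f := Category.comp_id (obj := C) f
  mul_assoc f g h := Category.assoc (obj := C) f g h

/-- The congruence `∼ₖ` on `A*`: the same (scattered) subwords of length at most `k`. -/
def subwordCon (A : Type) (k : ℕ) : Con (FreeMonoid A) where
  r u v := ∀ s : List A, s.length ≤ k → (s.Sublist u.toList ↔ s.Sublist v.toList)
  iseqv :=
    { refl := fun _ _ _ => Iff.rfl
      symm := fun h s hs => (h s hs).symm
      trans := fun h h' s hs => (h s hs).trans (h' s hs) }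
  mul' := by
    intro u u' v v' hu hv s hs
    simp only [FreeMonoid.toList_mul, List.sublist_append_iff]
    constructor
    · rintro ⟨s₁, s₂, rfl, h₁, h₂⟩
      rw [List.length_append] at hs
      exact ⟨s₁, s₂, rfl, (hu s₁ (by omega)).1 h₁, (hv s₂ (by omega)).1 h₂⟩
    · rintro ⟨s₁, s₂, rfl, h₁, h₂⟩
      rw [List.length_append] at hs
      exact ⟨s₁, s₂, rfl, (hu s₁ (by omega)).2 h₁, (hv s₂ (by omega)).2 h₂⟩

/-- The category `ker_k φ = ker(ψ_k ∘ φ⁻¹)`, where `ψ_k : A* → A*/∼ₖ` is the projection. -/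
abbrev SubwordKernelCat {A M : Type} [Monoid M] (k : ℕ) (φ : FreeMonoid A →* M) : Type :=
  KernelCat φ (subwordCon A k).mk'

/-- The bound `K = |M| (|A|² + |A|) / 2`. -/
noncomputable def kernelBound (A M : Type) : ℕ :=
  Nat.card M * ((Nat.card A ^ 2 + Nat.card A) / 2)

/-! ### Codes and decidability -/

/-- The entry in row `i` and column `j` of a table of natural numbers, if there is one. -/
def tableEntry (t : List (List ℕ)) (i j : ℕ) : Option ℕ := t[i]?.bind fun row => row[j]?

/-- `t` is a multiplication table of `M`, for some numbering `0, …, |M| - 1` of its elements. -/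
def IsMulTable (t : List (List ℕ)) (M : Type) [Monoid M] : Prop :=
  (∀ row ∈ t, row.length = t.length) ∧
    ∃ e : M ≃ Fin t.length, ∀ x y : M, tableEntry t (e x) (e y) = some (e (x * y) : ℕ)

/-- It is decidable whether a finite monoid, given by its multiplication table, belongs to `V`. -/
def DecidableMembership (V : MonoidClass) : Prop :=
  ComputablePred fun t : List (List ℕ) => ∃ (M : Type) (_ : Monoid M), IsMulTable t M ∧ V M

/-- Codes of finite categories: the number of objects, the list of the pairs (source, target) of the
arrows, and the composition table of the arrows. -/
abbrev CategoryCode : Type := ℕ × List (ℕ × ℕ) × List (List ℕ)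

/-- `c` is a code of the category `C`, for some numberings of its objects and of its arrows. The
entries of the composition table at pairs of arrows that are not consecutive are irrelevant. -/
def IsCategoryCode (c : CategoryCode) (C : Type) [Category.{0, 0} C] : Prop :=
  ∃ (o : C ≃ Fin c.1) (a : (Σ X Y : C, (X ⟶ Y)) ≃ Fin c.2.1.length),
    (∀ (X Y : C) (f : X ⟶ Y), c.2.1[a ⟨X, Y, f⟩] = ((o X : ℕ), (o Y : ℕ))) ∧
    ∀ (X Y Z : C) (f : X ⟶ Y) (g : Y ⟶ Z),
      tableEntry c.2.2 (a ⟨X, Y, f⟩) (a ⟨Y, Z, g⟩) = some (a ⟨X, Z, f ≫ g⟩ : ℕ)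

/-! ### Words absorbing letters -/

/-! The heart of the matter is the equivalence `twoSidedProduct_iff_baseMonoid`; decidability
follows from it by computing the kernel category.

Necessity of the condition on base monoids (`FactorsTwoSided.baseMonoid_mem`). Suppose `φ` factors
through `ψ` into a finite `𝒥`-trivial monoid `N` and `h` into `L ∈ V`. A loop `u` at an object of
`ker_k φ` is read in contexts `v`, `w` that absorb the letters of `u` with respect to `∼ₖ`, whereas
`ψ` may distinguish more than `∼ₖ`. For `k ≥ |M||A|` the contexts can be replaced by words with the
same `φ`-values that absorb these letters with respect to `ψ` too. Indeed, a word absorbing `C` up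
to a large length ends in a long sequence of blocks whose letter sets contain `C` and grow weakly
(`AbsorbsUpTo.exists_suffix`). If `|M|` consecutive blocks have the same letter set, then a factor
`z` consisting of some of them can be pumped without changing `φ`, and in `N` a suitable power of `ψ
z` absorbs every letter of `z`. Between absorbing contexts the transduction is multiplicative in
`u`, so the base monoid divides a finite power of `L`.

Sufficiency (`FactorsTwoSided.of_baseMonoid_mem`). Reading a word gives a path of objects (prefix
value, suffix value). In a `𝒥`-trivial monoid an object that has been left is never reached again,
so the path alternates between stretches of loops at one object and jumps, with at most one jump
from each object. A nontrivial `G ∈ V` records which jumps occur, and the base monoids record the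
products of the loops. Words with the same records take the same jumps, and their loops can be
exchanged stretch by stretch without changing `φ` (`KernelCat.map_eq_of_records_eq`).

Computability. Short words represent all pairs consisting of a class of `∼_K` and a value in `M`
(`exists_mem_tableWords`). Hence objects and arrows are classes of pairs and triples of short words
under primitive recursive relations. If `V` contains only trivial monoids, then `V ** J = J`, which
is decided directly. -/

theorem exists_suffix_eq_cons {A : Type} {C : Finset A} (hC : C.Nonempty) :
    ∀ v : List A, (∀ a ∈ C, a ∈ v) →
      ∃ (v' : List A) (b : A) (y : List A),
        v = v' ++ b :: y ∧ b ∈ C ∧ b ∉ y ∧ ∀ a ∈ C, a ∈ b :: y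
  | [], h => by
    obtain ⟨a, ha⟩ := hC
    exact absurd (h a ha) List.not_mem_nil
  | c :: v, h => by
    -- The shortest suffix that contains `C` is found: as long as the tail contains `C`, the head is
    -- dropped. When the tail first misses a letter of `C`, that letter is the head and does not
    -- recur.
    by_cases hv : ∀ a ∈ C, a ∈ v
    · obtain ⟨v', b, y, rfl, h1, h2, h3⟩ := exists_suffix_eq_cons hC v hv
      exact ⟨c :: v', b, y, rfl, h1, h2, h3⟩
    · push Not at hv
      obtain ⟨b, hb, hbv⟩ := hv
      obtain rfl : b = c := (List.mem_cons.1 (h b hb)).resolve_right hbv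
      exact ⟨[], b, v, rfl, hb, hbv, h⟩

/-- Appending a letter of `C` to `v` creates no new subwords of length at most `k`. -/
def AbsorbsUpTo {A : Type} (k : ℕ) (C : Finset A) (v : List A) : Prop :=
  ∀ a ∈ C, ∀ s : List A, s.length ≤ k → s.Sublist (v ++ [a]) → s.Sublist v

/-- The final `b` cannot be matched inside `y`, so it is matched at the displayed `b` or earlier,
and the rest lies in `x`. -/
theorem List.Sublist.of_concat_of_notMem {A : Type} {t x y : List A} {b : A}
    (h : (t ++ [b]).Sublist (x ++ b :: y)) (hb : b ∉ y) : t.Sublist x := by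
  rw [List.append_cons x b y, List.sublist_append_iff] at h
  obtain ⟨p, q, hpq, hp, hq⟩ := h
  rcases List.eq_nil_or_concat q with rfl | ⟨q', c, rfl⟩
  · rw [List.append_nil] at hpq
    rw [← hpq] at hp
    exact List.append_sublist_append_right _ |>.1 hp
  · rw [List.concat_eq_append, ← List.append_assoc] at hpq
    obtain ⟨-, h2⟩ := List.append_inj' hpq rfl
    obtain rfl : b = c := by simpa using h2
    exact absurd (hq.subset (by simp)) hb

/-- Let `b :: y` be the shortest suffix containing `C`. If `s₁d` is a subword of `v'd` with `d` in
this suffix, then `s₁db` is a subword of `vb`, hence of `v` since `b ∈ C`. As `b` does not occur in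
`y`, `s₁d` is already a subword of `v'`. One unit of length is lost, and the absorbed letter set
grows weakly. -/
theorem AbsorbsUpTo.exists_suffix {A : Type} [DecidableEq A] {k : ℕ} {C : Finset A} {v : List A}
    (hC : C.Nonempty) (h : AbsorbsUpTo (k + 1) C v) :
    ∃ v' y : List A, v = v' ++ y ∧ C ⊆ y.toFinset ∧ AbsorbsUpTo k y.toFinset v' := by
  have hCv : ∀ a ∈ C, a ∈ v := fun a ha => by
    simpa using h a ha [a] (by simp) (by simp)
  obtain ⟨v', b, y, rfl, hb, hby, hy⟩ := exists_suffix_eq_cons hC v hCv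
  refine ⟨v', b :: y, rfl, fun a ha => List.mem_toFinset.2 (hy a ha), ?_⟩
  intro d hd s hs hsub
  rw [List.mem_toFinset] at hd
  rw [List.sublist_append_iff] at hsub
  obtain ⟨s₁, s₂, rfl, h₁, h₂⟩ := hsub
  rcases List.sublist_singleton.1 h₂ with rfl | rfl
  · simpa using h₁
  · refine List.Sublist.of_concat_of_notMem (b := b) (y := y) (h b hb _ ?_ ?_) hby
    · simpa using hs
    · exact (h₁.append (List.singleton_sublist.2 hd)).append (List.Sublist.refl _)

/-- Suffixes are cut off `v` repeatedly. `zs` collects the latest blocks, all with letter set `C`,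
and `s` is what lies behind them. A cut either adds a block to `zs` or enlarges `C`; in the latter
case the count restarts at one. The quantity bounded by `k` decreases with each cut. -/
theorem AbsorbsUpTo.exists_stretch {A : Type} [Fintype A] [DecidableEq A] {m : ℕ} (hm : 0 < m) :
    ∀ (k : ℕ) (C : Finset A) (v : List A) (zs : List (List A)) (s : List A),
      C.Nonempty → AbsorbsUpTo k C v → (∀ z ∈ zs, z.toFinset = C) → (∀ a ∈ s, a ∈ C) →
      zs.length ≤ m → m - zs.length + m * (Fintype.card A - C.card) ≤ k →
      ∃ (B : Finset A) (p : List A) (zs' : List (List A)) (s' : List A), C ⊆ B ∧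
        v ++ (zs.flatten ++ s) = p ++ (zs'.flatten ++ s') ∧ zs'.length = m ∧
        (∀ z ∈ zs', z.toFinset = B) ∧ ∀ a ∈ s', a ∈ B := by
  intro k
  induction k with
  | zero =>
    intro C v zs s _ _ hzs hs hlen hk
    exact ⟨C, v, zs, s, Finset.Subset.refl _, rfl, by omega, hzs, hs⟩
  | succ k ih =>
    intro C v zs s hC hv hzs hs hlen hk
    rcases hlen.eq_or_lt with hlen | hlen
    · exact ⟨C, v, zs, s, Finset.Subset.refl _, rfl, hlen, hzs, hs⟩
    obtain ⟨v', y, rfl, hCy, hv'⟩ := hv.exists_suffix hC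
    by_cases hy : y.toFinset = C
    · obtain ⟨B, p, zs', s', h1, h2, h3⟩ := ih C v' (y :: zs) s hC (hy ▸ hv')
        (by simpa using ⟨hy, hzs⟩) hs (by simpa using hlen) (by simp only [List.length_cons]; omega)
      exact ⟨B, p, zs', s', h1, by rw [← h2]; simp, h3⟩
    · have hlt : C.card < y.toFinset.card :=
        Finset.card_lt_card (Finset.ssubset_iff_subset_ne.2 ⟨hCy, Ne.symm hy⟩)
      have hle : y.toFinset.card ≤ Fintype.card A := Finset.card_le_univ _
      have hmul : m * (Fintype.card A - y.toFinset.card) + m ≤ m * (Fintype.card A - C.card) := by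
        rw [← Nat.mul_succ]
        exact Nat.mul_le_mul_left _ (by omega)
      -- The letter set has grown: `y` is the first block of the new stretch, and the old blocks
      -- join the remainder.
      obtain ⟨B, p, zs', s', h1, h2, h3⟩ := ih y.toFinset v' [y] (zs.flatten ++ s) (hC.mono hCy) hv'
        (by simp) (by
          intro a ha
          rcases List.mem_append.1 ha with ha | ha
          · obtain ⟨z, hz, haz⟩ := List.mem_flatten.1 ha
            exact hCy (hzs z hz ▸ List.mem_toFinset.2 haz)
          · exact hCy (hs a ha)) hm (by simp only [List.length_singleton]; omega)
      exact ⟨B, p, zs', s', hCy.trans h1, by rw [← h2]; simp, h3⟩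

/-- A word that absorbs the letters of `C` has a factor that contains all letters of `C` and of the
suffix behind it and that can be pumped without changing the value under `φ`. -/
theorem AbsorbsUpTo.exists_pump {A M : Type} [Finite A] [Monoid M] [Finite M]
    (φ : FreeMonoid A →* M) {k : ℕ} {C : Finset A} {v : FreeMonoid A} (hC : C.Nonempty)
    (hk : Nat.card M * Nat.card A ≤ k) (h : AbsorbsUpTo k C v.toList) :
    ∃ x z r : FreeMonoid A, v = x * z * r ∧ φ x * φ z = φ x ∧ (∀ a ∈ C, a ∈ z.toList) ∧
      ∀ a ∈ r.toList, a ∈ z.toList := by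
  classical
  have := Fintype.ofFinite A
  have := Fintype.ofFinite M
  simp only [Nat.card_eq_fintype_card] at hk
  have hm : 0 < Fintype.card M := Fintype.card_pos
  -- Starting without blocks needs `|M| + |M|(|A| - |C|)` units, which is at most `|M||A|` because
  -- `C` is nonempty.
  obtain ⟨B, p, zs, s, hCB, heq, hlen, hzs, hs⟩ := h.exists_stretch hm k C v.toList [] [] hC
    (by simp) (by simp) (by simp) (by
      have h1 := hC.card_pos
      have h2 := Finset.card_le_univ C
      rw [List.length_nil, Nat.sub_zero, add_comm, ← Nat.mul_succ]
      exact (Nat.mul_le_mul_left _ (by omega)).trans hk)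
  -- The `|M|` blocks have `|M| + 1` ends of prefixes, so two of these prefixes have the same value.
  -- The blocks between them form the factor to be pumped.
  have hni : ¬ Function.Injective fun i : Fin (Fintype.card M + 1) =>
      φ (FreeMonoid.ofList (p ++ (zs.take i).flatten)) := fun hi => by
    have := Fintype.card_le_of_injective _ hi
    simp at this
  obtain ⟨i, j, hij, hφ⟩ : ∃ i j : Fin (Fintype.card M + 1), i < j ∧
      φ (FreeMonoid.ofList (p ++ (zs.take i).flatten)) =
        φ (FreeMonoid.ofList (p ++ (zs.take j).flatten)) := by
    simp only [Function.Injective] at hni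
    push Not at hni
    obtain ⟨i, j, h1, h2⟩ := hni
    rcases lt_or_gt_of_ne h2 with h | h
    exacts [⟨i, j, h, h1⟩, ⟨j, i, h, h1.symm⟩]
  have hij' : (i : ℕ) < j := hij
  have hj : (j : ℕ) < Fintype.card M + 1 := j.2
  have htake : zs.take j = zs.take i ++ (zs.take j).drop i := by
    conv_lhs => rw [← List.take_append_drop i (zs.take j), List.take_take, min_eq_left hij'.le]
  have hmem : ∀ a : A, a ∈ ((zs.take j).drop i).flatten ↔ a ∈ B := by
    intro a
    rw [List.mem_flatten]
    constructor
    · rintro ⟨z, hz, ha⟩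
      rw [← hzs z (List.mem_of_mem_take (List.mem_of_mem_drop hz))]
      exact List.mem_toFinset.2 ha
    · intro ha
      have hi : i < zs.length := by omega
      refine ⟨zs[(i : ℕ)], ?_, ?_⟩
      · rw [List.mem_drop_iff_getElem]
        exact ⟨0, by simp; omega, by simp⟩
      · rw [← List.mem_toFinset, hzs zs[(i : ℕ)] (List.getElem_mem hi)]
        exact ha
  refine ⟨FreeMonoid.ofList (p ++ (zs.take i).flatten),
    FreeMonoid.ofList ((zs.take j).drop i).flatten,
    FreeMonoid.ofList ((zs.drop j).flatten ++ s), ?_, ?_, ?_, ?_⟩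
  · apply FreeMonoid.toList.injective
    simp only [List.flatten_nil, List.append_nil] at heq
    simp only [FreeMonoid.toList_mul, FreeMonoid.toList_ofList, heq]
    conv_lhs => rw [← List.take_append_drop j zs, htake]
    simp
  · rw [← map_mul, ← FreeMonoid.ofList_append, hφ]
    conv_rhs => rw [htake]
    simp
  · intro a ha
    exact (hmem a).2 (hCB ha)
  · intro a ha
    refine (hmem a).2 ?_
    simp only [FreeMonoid.toList_ofList, List.mem_append] at ha
    rcases ha with ha | ha
    · obtain ⟨z, hz, ha⟩ := List.mem_flatten.1 ha
      rw [← hzs z (List.mem_of_mem_drop hz)]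
      exact List.mem_toFinset.2 ha
    · exact hs a ha

/-! ### Finite `𝒥`-trivial monoids -/

theorem ClassJ.eq_of_mul {N : Type} [Monoid N] (hN : ClassJ N) {s t a b c d : N}
    (hs : s = a * t * b) (ht : t = c * s * d) : s = t := by
  refine hN.2 s t (Set.ext fun x => ⟨?_, ?_⟩)
  · rintro ⟨p, q, rfl⟩
    exact ⟨p * a, b * q, by rw [hs]; simp only [mul_assoc]⟩
  · rintro ⟨p, q, rfl⟩
    exact ⟨p * c, d * q, by rw [ht]; simp only [mul_assoc]⟩

theorem ClassJ.of_eq_of_mul {N : Type} [Monoid N] [Finite N]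
    (h : ∀ s t a b c d : N, s = a * t * b → t = c * s * d → s = t) : ClassJ N := by
  refine ⟨‹_›, fun s t hst => ?_⟩
  obtain ⟨a, b, hs⟩ : s ∈ {x : N | ∃ a b : N, x = a * t * b} := hst ▸ ⟨1, 1, by simp⟩
  obtain ⟨c, d, ht⟩ : t ∈ {x : N | ∃ a b : N, x = a * s * b} := hst ▸ ⟨1, 1, by simp⟩
  exact h s t a b c d hs ht

/-- `n` and `n * a` generate the same two-sided ideal: a prefix value that is reached again was
never left. -/
theorem ClassJ.mul_eq_left {N : Type} [Monoid N] (hN : ClassJ N) {n a b : N}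
    (h : n * a * b = n) : n * a = n :=
  hN.eq_of_mul (a := 1) (b := a) (c := 1) (d := b) (by simp) (by simp [h])

theorem ClassJ.mul_eq_right {N : Type} [Monoid N] (hN : ClassJ N) {n a b : N}
    (h : a * (b * n) = n) : b * n = n :=
  hN.eq_of_mul (a := b) (b := 1) (c := a) (d := 1) (by simp) (by simp [h])

theorem ClassJ.op {N : Type} [Monoid N] (hN : ClassJ N) : ClassJ Nᵐᵒᵖ := by
  have := hN.1
  have : Finite Nᵐᵒᵖ := Finite.of_equiv N MulOpposite.opEquiv
  refine ClassJ.of_eq_of_mul fun s t a b c d hs ht => MulOpposite.unop_injective ?_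
  exact hN.eq_of_mul (a := b.unop) (b := a.unop) (c := d.unop) (d := c.unop)
    (by rw [hs]; simp [mul_assoc]) (by conv_lhs => rw [ht]
                                       simp [mul_assoc])

theorem exists_isIdempotentElem_pow {N : Type} [Monoid N] [Finite N] (z : N) :
    ∃ n : ℕ, 0 < n ∧ IsIdempotentElem (z ^ n) := by
  obtain ⟨i, j, hij, h⟩ : ∃ i j : ℕ, i < j ∧ z ^ i = z ^ j := by
    obtain ⟨i, j, h1, h2⟩ := Finite.exists_ne_map_eq_of_infinite fun n : ℕ => z ^ n
    rcases lt_or_gt_of_ne h1 with h | h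
    exacts [⟨i, j, h, h2⟩, ⟨j, i, h, h2.symm⟩]
  have key : ∀ m t : ℕ, i ≤ m → z ^ (m + t * (j - i)) = z ^ m := by
    intro m t hm
    induction t with
    | zero => simp
    | succ t ih =>
      rw [show m + (t + 1) * (j - i) = (m - i + t * (j - i)) + j by
        rw [Nat.succ_mul]; omega, pow_add, ← h, ← pow_add,
        show m - i + t * (j - i) + i = m + t * (j - i) by omega, ih]
  -- The exponent is a positive multiple of the period `j - i` and is at least `i`.
  refine ⟨(i + 1) * (j - i), Nat.mul_pos i.succ_pos (by omega), ?_⟩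
  rw [IsIdempotentElem, ← pow_add]
  exact key _ _ ((Nat.le_mul_of_pos_right i (by omega)).trans (Nat.mul_le_mul_right _ i.le_succ))

/-- Write `z = xay` and let `e` be the idempotent power. From `e = e * e` it follows that `e` is
restored after multiplying by `ψ x`, `ψ a` and further factors. By `𝒥`-triviality none of these
steps changes `e`. -/
theorem ClassJ.pow_mul_of_mem {A N : Type} [Monoid N] (hN : ClassJ N) (ψ : FreeMonoid A →* N)
    {z : FreeMonoid A} {n : ℕ} (hn : 0 < n) (hz : IsIdempotentElem (ψ z ^ n)) {a : A}
    (ha : a ∈ z.toList) : ψ z ^ n * ψ (FreeMonoid.of a) = ψ z ^ n := by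
  obtain ⟨x, y, hxy⟩ := List.append_of_mem ha
  have hz' : ψ z = ψ (FreeMonoid.ofList x) * ψ (FreeMonoid.of a) * ψ (FreeMonoid.ofList y) := by
    rw [← map_mul, ← map_mul]
    congr 1
    apply FreeMonoid.toList.injective
    simp [hxy]
  have h1 : ψ z ^ n * (ψ (FreeMonoid.ofList x) * ψ (FreeMonoid.of a)) *
      (ψ (FreeMonoid.ofList y) * ψ z ^ (n - 1)) = ψ z ^ n := by
    calc _ = ψ z ^ n * (ψ z * ψ z ^ (n - 1)) := by rw [hz']; simp only [mul_assoc]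
      _ = ψ z ^ n * ψ z ^ n := by rw [← pow_succ', Nat.sub_add_cancel hn]
      _ = _ := hz
  have h2 := hN.mul_eq_left h1
  rw [← mul_assoc] at h2
  have h3 := hN.mul_eq_left h2
  rwa [h3] at h2

theorem mul_map_eq_of_forall_mem {A N : Type} [Monoid N] (ψ : FreeMonoid A →* N) {n : N} :
    ∀ {u : FreeMonoid A}, (∀ a ∈ u.toList, n * ψ (FreeMonoid.of a) = n) → n * ψ u = n := by
  intro u
  induction u using FreeMonoid.inductionOn' with
  | one => simp
  | of_mul a u ih =>
    intro h
    rw [map_mul, ← mul_assoc, h a (by simp)]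
    exact ih fun b hb => h b (by simp [hb])

/-- If `v` absorbs the letters of `C` up to a large length, then some word with the same value under
`φ` absorbs them with respect to any homomorphism into a finite `𝒥`-trivial monoid. -/
theorem exists_absorbing_left {A M N : Type} [Finite A] [Monoid M] [Finite M] [Monoid N]
    (hN : ClassJ N) (φ : FreeMonoid A →* M) (ψ : FreeMonoid A →* N) {k : ℕ} {C : Finset A}
    {v : FreeMonoid A} (hk : Nat.card M * Nat.card A ≤ k) (h : AbsorbsUpTo k C v.toList) :
    ∃ v' : FreeMonoid A, φ v' = φ v ∧ ∀ a ∈ C, ψ v' * ψ (FreeMonoid.of a) = ψ v' := by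
  rcases C.eq_empty_or_nonempty with rfl | hC
  · exact ⟨v, rfl, by simp⟩
  have := hN.1
  obtain ⟨x, z, r, rfl, h1, h2, h3⟩ := h.exists_pump φ hC hk
  obtain ⟨n, hn, hz⟩ := exists_isIdempotentElem_pow (ψ z)
  have hr : ψ z ^ n * ψ r = ψ z ^ n :=
    mul_map_eq_of_forall_mem ψ fun a ha => hN.pow_mul_of_mem ψ hn hz (h3 a ha)
  -- Pumping is invisible to `φ` because `φ x * φ z = φ x`. The idempotent `ψ z ^ n` swallows `r`,
  -- whose letters all occur in `z`, and then the letters of `C`.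
  refine ⟨x * z ^ n * r, ?_, fun a ha => ?_⟩
  · have : ∀ n : ℕ, φ x * φ z ^ n = φ x := fun n => by
      induction n with
      | zero => simp
      | succ n ih => rw [pow_succ, ← mul_assoc, ih, h1]
    simp [this, h1]
  · rw [map_mul, map_mul, map_pow, mul_assoc (ψ x), hr, mul_assoc,
      hN.pow_mul_of_mem ψ hn hz (h2 a ha)]

/-- The homomorphism into the opposite monoid that reads words from right to left. -/
def reverseHom {A M : Type} [Monoid M] (φ : FreeMonoid A →* M) : FreeMonoid A →* Mᵐᵒᵖ :=
  FreeMonoid.lift fun a => MulOpposite.op (φ (FreeMonoid.of a))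

theorem reverseHom_apply {A M : Type} [Monoid M] (φ : FreeMonoid A →* M) (u : FreeMonoid A) :
    reverseHom φ u = MulOpposite.op (φ (FreeMonoid.ofList u.toList.reverse)) := by
  induction u using FreeMonoid.inductionOn' with
  | one => simp
  | of_mul a u ih =>
    rw [map_mul, ih]
    simp [reverseHom, FreeMonoid.ofList_append]

/-- The left-hand version is applied to reversed words and opposite monoids. -/
theorem exists_absorbing_right {A M N : Type} [Finite A] [Monoid M] [Finite M] [Monoid N]
    (hN : ClassJ N) (φ : FreeMonoid A →* M) (ψ : FreeMonoid A →* N) {k : ℕ} {C : Finset A}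
    {w : FreeMonoid A} (hk : Nat.card M * Nat.card A ≤ k)
    (h : AbsorbsUpTo k C w.toList.reverse) :
    ∃ w' : FreeMonoid A, φ w' = φ w ∧ ∀ a ∈ C, ψ (FreeMonoid.of a) * ψ w' = ψ w' := by
  have : Finite Mᵐᵒᵖ := Finite.of_equiv M MulOpposite.opEquiv
  obtain ⟨v, h1, h2⟩ := exists_absorbing_left hN.op (reverseHom φ) (reverseHom ψ)
    (v := FreeMonoid.ofList w.toList.reverse)
    (by rwa [Nat.card_congr MulOpposite.opEquiv.symm]) h
  simp only [reverseHom_apply] at h1 h2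
  refine ⟨FreeMonoid.ofList v.toList.reverse, by simpa using MulOpposite.op_injective h1,
    fun a ha => ?_⟩
  simpa using congrArg MulOpposite.unop (h2 a ha)

/-! ### Division and direct products -/

/-- On the range of `g`, the assignment `g x ↦ q x` is well defined. -/
theorem MonoidDivides.of_factors {S B G : Type} [Monoid S] [Monoid B] [Monoid G] (q : S →* B)
    (hq : Function.Surjective q) (g : S →* G) (h : ∀ x y, g x = g y → q x = q y) :
    MonoidDivides B G := by
  choose s hs using fun x : MonoidHom.mrange g => x.2
  refine ⟨MonoidHom.mrange g,
    { toFun := fun x => q (s x)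
      map_one' := ?_
      map_mul' := fun x y => ?_ }, fun b => ?_⟩
  · rw [← map_one q]
    apply h
    rw [hs, map_one]
    rfl
  · rw [← map_mul q]
    apply h
    rw [hs, map_mul, hs, hs]
    rfl
  · obtain ⟨x, rfl⟩ := hq b
    exact ⟨⟨g x, x, rfl⟩, h _ _ (hs _)⟩

theorem MonoidDivides.of_injective {B G : Type} [Monoid B] [Monoid G] (g : B →* G)
    (hg : Function.Injective g) : MonoidDivides B G :=
  .of_factors (MonoidHom.id B) Function.surjective_id g fun _ _ h => hg h

theorem MonoidDivides.of_surjective {B G : Type} [Monoid B] [Monoid G] (q : G →* B)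
    (hq : Function.Surjective q) : MonoidDivides B G :=
  .of_factors q hq (MonoidHom.id G) fun _ _ h => congrArg q h

theorem IsPseudovariety.of_mulEquiv {V : MonoidClass} (hV : IsPseudovariety V) {M N : Type}
    [Monoid M] [Monoid N] (e : M ≃* N) (hM : V M) : V N :=
  hV.division N M hM (.of_surjective e.toMonoidHom e.surjective)

theorem IsPseudovariety.prod_bool {V : MonoidClass} (hV : IsPseudovariety V) (F : Bool → Type)
    [∀ b, Monoid (F b)] (hF : ∀ b, V (F b)) : V (F true × F false) := by
  refine hV.division _ _ (hV.prod Bool F hF) (.of_surjective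
    (MonoidHom.prod (Pi.evalMonoidHom F true) (Pi.evalMonoidHom F false)) fun x => ?_)
  exact ⟨fun b => Bool.rec (motive := F) x.2 x.1 b, rfl⟩

theorem IsPseudovariety.binary_prod {V : MonoidClass} (hV : IsPseudovariety V) {M N : Type}
    [iM : Monoid M] [iN : Monoid N] (hM : V M) (hN : V N) : V (M × N) :=
  @IsPseudovariety.prod_bool V hV (fun b => Bool.rec N M b)
    (fun b => Bool.rec (motive := fun b => Monoid (Bool.rec N M b)) iN iM b)
    (by rintro (_ | _); exacts [hN, hM])

theorem IsPseudovariety.of_subsingleton {V : MonoidClass} (hV : IsPseudovariety V) (M : Type)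
    [Monoid M] [Subsingleton M] : V M :=
  hV.division _ _ (hV.prod Empty (fun _ => PUnit) fun e => e.elim)
    (.of_injective (1 : M →* (Empty → PUnit)) fun _ _ _ => Subsingleton.elim _ _)

/-! ### Loops of the kernel category -/

namespace KernelCat

variable {A M N : Type} [Monoid M] [Monoid N] {φ : FreeMonoid A →* M} {ψ : FreeMonoid A →* N}

/-- The words that represent arrows from `X` to `X`. -/
def loops (X : KernelCat φ ψ) : Submonoid (FreeMonoid A) where
  carrier := {u | X.left * ψ u = X.left ∧ ψ u * X.right = X.right}
  one_mem' := by simp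
  mul_mem' := by
    rintro u v ⟨h1, h2⟩ ⟨h3, h4⟩
    exact ⟨by rw [map_mul, ← mul_assoc, h1, h3], by rw [map_mul, mul_assoc, h4, h2]⟩

/-- The element of the base monoid that a loop represents. -/
def loopHom (X : KernelCat φ ψ) : X.loops →* BaseMonoid X where
  toFun u := Quotient.mk (repSetoid X X) ⟨u.1, u.2⟩
  map_one' := rfl
  map_mul' _ _ := rfl

theorem loopHom_surjective (X : KernelCat φ ψ) : Function.Surjective X.loopHom := by
  rintro ⟨u, hu⟩
  exact ⟨⟨u, hu⟩, rfl⟩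

theorem loopHom_eq_iff (X : KernelCat φ ψ) (u u' : X.loops) :
    X.loopHom u = X.loopHom u' ↔ ∀ v w : FreeMonoid A, ψ v = X.left → ψ w = X.right →
      φ (v * u * w) = φ (v * u' * w) :=
  ⟨fun h => Quotient.exact h, fun h => Quotient.sound h⟩

/-- A loop returns to `X` on both sides, so by `𝒥`-triviality neither coordinate ever changes and
each single letter is a loop. -/
theorem mem_loops_iff (hN : ClassJ N) (X : KernelCat φ ψ) (u : FreeMonoid A) :
    u ∈ X.loops ↔ ∀ a ∈ u.toList, FreeMonoid.of a ∈ X.loops := by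
  constructor
  · rintro ⟨h1, h2⟩ a ha
    obtain ⟨x, y, hxy⟩ := List.append_of_mem ha
    obtain rfl : u = FreeMonoid.ofList x * FreeMonoid.of a * FreeMonoid.ofList y :=
      FreeMonoid.toList.injective (by simp [hxy])
    simp only [map_mul, ← mul_assoc] at h1
    simp only [map_mul, mul_assoc] at h2
    have h3 : X.left * ψ (FreeMonoid.ofList x) = X.left :=
      hN.mul_eq_left (b := ψ (FreeMonoid.of a) * ψ (FreeMonoid.ofList y)) (by rw [← mul_assoc, h1])
    have h4 : ψ (FreeMonoid.ofList y) * X.right = X.right :=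
      hN.mul_eq_right (a := ψ (FreeMonoid.ofList x) * ψ (FreeMonoid.of a)) (by rw [mul_assoc, h2])
    rw [h3] at h1
    rw [h4] at h2
    exact ⟨hN.mul_eq_left h1, hN.mul_eq_right h2⟩
  · intro h
    induction u using FreeMonoid.inductionOn' with
    | one => exact X.loops.one_mem
    | of_mul a u ih =>
      exact X.loops.mul_mem (h a (by simp)) (ih fun b hb => h b (by simp [hb]))

end KernelCat

/-! ### The monoids `A* / ∼ₖ` -/

theorem subwordCon_quotient_finite (A : Type) [Finite A] (k : ℕ) :
    Finite (subwordCon A k).Quotient := by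
  have : Finite {s : List A // s.length ≤ k} := (List.finite_length_le A k).to_subtype
  refine Finite.of_injective (β := Set {s : List A // s.length ≤ k})
    (fun x => Con.liftOn x (fun u => {s | s.1.Sublist u.toList}) fun u v h =>
      Set.ext fun s => h s.1 s.2) ?_
  intro x y
  induction x using Con.induction_on with | H u => ?_
  induction y using Con.induction_on with | H v => ?_
  intro h
  refine (subwordCon A k).eq.2 fun s hs => ?_
  exact Set.ext_iff.1 h ⟨s, hs⟩

/-- Multiplication can only add subwords, so elements that are multiples of each other have the same
subwords. -/
theorem subwordCon_quotient_classJ (A : Type) [Finite A] (k : ℕ) :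
    ClassJ (subwordCon A k).Quotient := by
  have := subwordCon_quotient_finite A k
  refine ClassJ.of_eq_of_mul fun s t a b c d hs ht => ?_
  induction s using Con.induction_on with | H s => ?_
  induction t using Con.induction_on with | H t => ?_
  induction a using Con.induction_on with | H a => ?_
  induction b using Con.induction_on with | H b => ?_
  induction c using Con.induction_on with | H c => ?_
  induction d using Con.induction_on with | H d => ?_
  have key : ∀ {x y z w : FreeMonoid A},
      (x : (subwordCon A k).Quotient) = y * z * w → ∀ r : List A, r.length ≤ k →
        r.Sublist z.toList → r.Sublist x.toList := by
    intro x y z w h r hr hz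
    have h' : subwordCon A k x (y * z * w) := (subwordCon A k).eq.1 h
    refine (h' r hr).2 (hz.trans ?_)
    simp only [FreeMonoid.toList_mul, List.append_assoc]
    exact (List.sublist_append_left _ _).trans (List.sublist_append_right _ _)
  exact (subwordCon A k).eq.2 fun r hr => ⟨key ht r hr, key hs r hr⟩

/-! ### Transducing words between absorbing contexts -/

/-- The value of `h` on the factor `u` of a word, read between prefixes of value `p` and suffixes of
value `q`. -/
def contextHom {A N L : Type} [Monoid N] [Monoid L] (ψ : FreeMonoid A →* N)
    (h : FreeMonoid (N × A × N) →* L) (S : Submonoid (FreeMonoid A)) (p q : N)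
    (hS : ∀ u ∈ S, p * ψ u = p ∧ ψ u * q = q) : S →* L where
  toFun u := h (shiftMap p q (transduction ψ u))
  map_one' := by simp [transduction_one]
  map_mul' u v := by
    rw [Submonoid.coe_mul, transduction_mul, map_mul, map_mul, shiftMap_shiftMap,
      shiftMap_shiftMap, (hS u u.2).1, (hS v v.2).2, mul_one, one_mul]

theorem map_transduction_context {A N L : Type} [Monoid N] [Monoid L] (ψ : FreeMonoid A →* N)
    (h : FreeMonoid (N × A × N) →* L) (v u w : FreeMonoid A) (hv : ψ v * ψ u = ψ v)
    (hw : ψ u * ψ w = ψ w) :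
    h (transduction ψ (v * u * w)) =
      h (shiftMap 1 (ψ w) (transduction ψ v)) * h (shiftMap (ψ v) (ψ w) (transduction ψ u)) *
        h (shiftMap (ψ v) 1 (transduction ψ w)) := by
  simp only [transduction_mul, map_mul, shiftMap_shiftMap, hv, hw, one_mul, mul_one]

/-- The pumping argument needs only length `|M||A|`, and `|A| ≤ |A|²`. -/
theorem kernelBound_ge (A M : Type) : Nat.card M * Nat.card A ≤ kernelBound A M := by
  refine Nat.mul_le_mul_left _ ((Nat.le_div_iff_mul_le two_pos).2 ?_)
  rcases Nat.eq_zero_or_pos (Nat.card A) with h | h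
  · simp [h]
  · nlinarith

/-- The base monoids of `ker_k φ`, for `k` large, lie in `V` if `φ` belongs to a monoid of
`V ** J`. -/
theorem FactorsTwoSided.baseMonoid_mem {V : MonoidClass} (hV : IsPseudovariety V) {A M : Type}
    [Finite A] [Monoid M] [Finite M] {φ : FreeMonoid A →* M} (hφ : FactorsTwoSided V ClassJ φ)
    {k : ℕ} (hk : Nat.card M * Nat.card A ≤ k) (X : SubwordKernelCat k φ) :
    V (BaseMonoid X) := by
  classical
  obtain ⟨N, _, L, _, ψ, h, hN, hL, H⟩ := hφ
  have := hN.1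
  have := Fintype.ofFinite A
  have hJ := subwordCon_quotient_classJ A k
  -- All pairs of context values that absorb the loops at `X`. This set is finite, and in each such
  -- context the value of `h` is multiplicative on loops.
  let P := {x : N × N // ∀ u ∈ X.loops, x.1 * ψ u = x.1 ∧ ψ u * x.2 = x.2}
  let g : X.loops →* (P → L) :=
    MonoidHom.pi fun x => contextHom ψ h X.loops x.1.1 x.1.2 x.2
  refine hV.division _ _ (hV.prod P (fun _ => L) fun _ => hL)
    (.of_factors X.loopHom X.loopHom_surjective g fun u u' huu' => ?_)
  rw [KernelCat.loopHom_eq_iff]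
  intro v w hv hw
  -- The letters that are loops at `X`: appending one to `v` or prepending one to `w` does not
  -- change the class modulo `∼ₖ`.
  let C : Finset A := Finset.univ.filter fun a => FreeMonoid.of a ∈ X.loops
  have hvC : AbsorbsUpTo k C v.toList := by
    intro a ha s hs hsub
    have h1 := (Finset.mem_filter.1 ha).2.1
    rw [← hv, ← map_mul] at h1
    exact ((subwordCon A k).eq.1 h1 s hs).1 hsub
  have hwC : AbsorbsUpTo k C w.toList.reverse := by
    intro a ha s hs hsub
    have h1 := (Finset.mem_filter.1 ha).2.2
    rw [← hw, ← map_mul] at h1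
    rw [← List.reverse_sublist, List.reverse_reverse]
    refine ((subwordCon A k).eq.1 h1 _ (by simpa using hs)).1 ?_
    rw [← List.reverse_sublist]
    simpa using hsub
  obtain ⟨v', hv1, hv2⟩ := exists_absorbing_left hN φ ψ hk hvC
  obtain ⟨w', hw1, hw2⟩ := exists_absorbing_right hN φ ψ hk hwC
  have hP : ∀ u ∈ X.loops, ψ v' * ψ u = ψ v' ∧ ψ u * ψ w' = ψ w' := by
    intro u hu
    rw [KernelCat.mem_loops_iff hJ] at hu
    constructor
    · exact mul_map_eq_of_forall_mem ψ fun a ha => hv2 a (by simpa [C] using hu a ha)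
    · induction u using FreeMonoid.inductionOn' with
      | one => simp
      | of_mul a u ih =>
        rw [map_mul, mul_assoc, ih fun b hb => hu b (by simp [hb]),
          hw2 a (by simpa [C] using hu a (by simp))]
  have hg : h (shiftMap (ψ v') (ψ w') (transduction ψ u)) =
      h (shiftMap (ψ v') (ψ w') (transduction ψ u')) :=
    congrFun huu' ⟨(ψ v', ψ w'), hP⟩
  have hu := hP u u.2
  have hu' := hP u' u'.2
  -- In these contexts `u` and `u'` are invisible to `ψ`, and the transductions differ only in the
  -- middle factor, where `h` agrees.
  have := H (v' * u * w') (v' * u' * w')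
    (by simp only [map_mul, hu.1, hu'.1])
    (by rw [map_transduction_context ψ h v' u w' hu.1 hu.2,
      map_transduction_context ψ h v' u' w' hu'.1 hu'.2, hg])
  simpa only [map_mul, hv1, hw1] using this

/-! ### Recording jumps and loops -/

theorem transduction_of_mul {A N : Type} [Monoid N] (ψ : FreeMonoid A →* N) (n n' : N) (a : A)
    (v : FreeMonoid A) :
    shiftMap n n' (transduction ψ (FreeMonoid.of a * v)) =
      FreeMonoid.of (n, a, ψ v * n') *
        shiftMap (n * ψ (FreeMonoid.of a)) n' (transduction ψ v) := by
  rw [transduction_mul, map_mul, shiftMap_shiftMap, shiftMap_shiftMap, transduction_of]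
  simp [shiftMap]

theorem transduction_mul_of_mul {A N : Type} [Monoid N] (ψ : FreeMonoid A →* N) (n n' : N)
    (u : FreeMonoid A) (a : A) (v : FreeMonoid A) :
    shiftMap n n' (transduction ψ (u * (FreeMonoid.of a * v))) =
      shiftMap n (ψ (FreeMonoid.of a * v) * n') (transduction ψ u) *
        (FreeMonoid.of (n * ψ u, a, ψ v * n') *
          shiftMap (n * ψ u * ψ (FreeMonoid.of a)) n' (transduction ψ v)) := by
  rw [transduction_mul, map_mul, shiftMap_shiftMap, shiftMap_shiftMap, one_mul, mul_one,
    transduction_of_mul]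

/-- If a homomorphism is not trivial on a transduced word, then it is not trivial on one of its
letters. -/
theorem exists_letter_of_ne_one {A N L : Type} [Monoid N] [Monoid L] (ψ : FreeMonoid A →* N)
    (h : FreeMonoid (N × A × N) →* L) (n' : N) (v : FreeMonoid A) :
    ∀ n : N, h (shiftMap n n' (transduction ψ v)) ≠ 1 →
      ∃ (v₁ : FreeMonoid A) (a : A) (v₂ : FreeMonoid A), v = v₁ * (FreeMonoid.of a * v₂) ∧
        h (FreeMonoid.of (n * ψ v₁, a, ψ v₂ * n')) ≠ 1 := by
  induction v using FreeMonoid.inductionOn' with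
  | one => intro n hn; simp [transduction_one] at hn
  | of_mul a v ih =>
    intro n hn
    by_cases h1 : h (FreeMonoid.of (n, a, ψ v * n')) = 1
    · rw [transduction_of_mul, map_mul, h1, one_mul] at hn
      obtain ⟨v₁, b, v₂, rfl, hb⟩ := ih _ hn
      exact ⟨FreeMonoid.of a * v₁, b, v₂, by rw [mul_assoc], by rwa [map_mul, ← mul_assoc]⟩
    · exact ⟨1, a, v, by rw [one_mul], by simpa using h1⟩

namespace KernelCat

variable {A M N : Type} [Monoid M] [Monoid N]

/-- The letters `(n, a, n')` for which `a` is a loop at `(n, n')`. -/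
def IsLoopLetter (ψ : FreeMonoid A →* N) (x : N × A × N) : Prop :=
  x.1 * ψ (FreeMonoid.of x.2.1) = x.1 ∧ ψ (FreeMonoid.of x.2.1) * x.2.2 = x.2.2

open Classical in
/-- The homomorphism that sends the letter `y` to `g` if `y` is not a loop letter, and all other
letters to `1`. -/
noncomputable def jumpHom {G : Type} [Monoid G] (ψ : FreeMonoid A →* N) (g : G) (y : N × A × N) :
    FreeMonoid (N × A × N) →* G :=
  FreeMonoid.lift fun x => if x = y ∧ ¬ IsLoopLetter ψ x then g else 1

open Classical in
/-- The homomorphism that multiplies the loops at `X`. -/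
noncomputable def baseHom {φ : FreeMonoid A →* M} {ψ : FreeMonoid A →* N} (X : KernelCat φ ψ) :
    FreeMonoid (N × A × N) →* BaseMonoid X :=
  FreeMonoid.lift fun x =>
    if hx : (x.1 = X.left ∧ x.2.2 = X.right) ∧ FreeMonoid.of x.2.1 ∈ X.loops then
      X.loopHom ⟨FreeMonoid.of x.2.1, hx.2⟩ else 1

theorem jumpHom_ne_one {G : Type} [Monoid G] {ψ : FreeMonoid A →* N} {g : G} {x y : N × A × N}
    (h : jumpHom ψ g y (FreeMonoid.of x) ≠ 1) : x = y ∧ ¬ IsLoopLetter ψ x := by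
  by_contra hn
  rw [jumpHom, FreeMonoid.lift_eval_of, if_neg hn] at h
  exact h rfl

theorem jumpHom_self {G : Type} [Monoid G] {ψ : FreeMonoid A →* N} (g : G) {x : N × A × N}
    (h : ¬ IsLoopLetter ψ x) : jumpHom ψ g x (FreeMonoid.of x) = g := by
  rw [jumpHom, FreeMonoid.lift_eval_of, if_pos ⟨rfl, h⟩]

variable {φ : FreeMonoid A →* M} {ψ : FreeMonoid A →* N}

theorem baseHom_ne_one {X : KernelCat φ ψ} {x : N × A × N}
    (h : baseHom X (FreeMonoid.of x) ≠ 1) :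
    (x.1 = X.left ∧ x.2.2 = X.right) ∧ FreeMonoid.of x.2.1 ∈ X.loops := by
  by_contra hn
  rw [baseHom, FreeMonoid.lift_eval_of, dif_neg hn] at h
  exact h rfl

theorem mul_mem_loops_iff (hN : ClassJ N) (X : KernelCat φ ψ) (u v : FreeMonoid A) :
    u * v ∈ X.loops ↔ u ∈ X.loops ∧ v ∈ X.loops := by
  rw [mem_loops_iff hN, mem_loops_iff hN, mem_loops_iff hN, ← List.forall_mem_append]
  rfl

/-- On a loop at `X`, the loops at `X` multiply to its class. -/
theorem baseHom_loop (hN : ClassJ N) (X : KernelCat φ ψ) (u : FreeMonoid A) (hu : u ∈ X.loops) :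
    baseHom X (shiftMap X.left X.right (transduction ψ u)) = X.loopHom ⟨u, hu⟩ := by
  induction u using FreeMonoid.inductionOn' with
  | one => rw [transduction_one, map_one, map_one]; exact (map_one X.loopHom).symm
  | of_mul a u ih =>
    obtain ⟨ha, hu'⟩ := (mul_mem_loops_iff hN X _ _).1 hu
    rw [transduction_of_mul, ha.1, hu'.2, map_mul, ih hu', baseHom, FreeMonoid.lift_eval_of,
      dif_pos ⟨⟨rfl, rfl⟩, ha⟩, ← map_mul]
    rfl

/-- The word is split at the first letter that changes the object (prefix value, suffix value). -/
theorem eq_loop_or_exists_jump (ψ : FreeMonoid A →* N) (n n' : N) (v : FreeMonoid A) :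
    (n * ψ v = n ∧ ψ v * n' = n') ∨
      ∃ (u : FreeMonoid A) (a : A) (v' : FreeMonoid A), v = u * (FreeMonoid.of a * v') ∧
        n * ψ u = n ∧ ψ v * n' = ψ (FreeMonoid.of a * v') * n' ∧
        ¬ IsLoopLetter ψ (n, a, ψ v' * n') := by
  induction v using FreeMonoid.inductionOn' with
  | one => simp
  | of_mul a v ih =>
    by_cases ha : IsLoopLetter ψ (n, a, ψ v * n')
    · obtain ⟨h1, h2⟩ := ha
      simp only at h1 h2
      rcases ih with ⟨h3, h4⟩ | ⟨u, b, v', rfl, h3, h4, h5⟩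
      · left
        rw [h4] at h2
        exact ⟨by rw [map_mul, ← mul_assoc, h1, h3], by rw [map_mul, mul_assoc, h4, h2]⟩
      · right
        refine ⟨FreeMonoid.of a * u, b, v', by rw [mul_assoc], ?_, ?_, h5⟩
        · rw [map_mul, ← mul_assoc, h1, h3]
        · rw [map_mul, mul_assoc, h2, h4]
    · exact Or.inr ⟨1, a, v, by rw [one_mul], by simp, rfl, ha⟩

/-- Each letter of a loop is a loop letter, so no jump is recorded. -/
theorem jumpHom_loop (hN : ClassJ N) {G : Type} [Monoid G] (g : G) (y : N × A × N) {n n' : N}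
    {u : FreeMonoid A} (h1 : n * ψ u = n) (h2 : ψ u * n' = n') :
    jumpHom ψ g y (shiftMap n n' (transduction ψ u)) = 1 := by
  by_contra hne
  obtain ⟨u₁, a, u₂, rfl, ha⟩ := exists_letter_of_ne_one ψ _ n' u n hne
  have hu : u₁ * (FreeMonoid.of a * u₂) ∈ (⟨n, n'⟩ : KernelCat (1 : FreeMonoid A →* N) ψ).loops :=
    ⟨h1, h2⟩
  rw [mul_mem_loops_iff hN, mul_mem_loops_iff hN] at hu
  obtain ⟨hu₁, ha', hu₂⟩ := hu
  refine (jumpHom_ne_one ha).2 ?_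
  rw [hu₁.1, hu₂.2]
  exact ha'

/-- After a jump, the source of the jump is not reached again. -/
theorem not_return (hN : ClassJ N) {n n' : N} {a : A} {v₁ v₂ : FreeMonoid A}
    (hl : n * ψ (FreeMonoid.of a) * ψ v₁ = n)
    (hr : ψ v₂ * n' = ψ (FreeMonoid.of a) * (ψ v₁ * (ψ v₂ * n'))) :
    IsLoopLetter ψ (n, a, ψ v₁ * (ψ v₂ * n')) := by
  have h := hN.mul_eq_right hr.symm
  refine ⟨hN.mul_eq_left hl, ?_⟩
  rw [h]
  exact (h ▸ hr).symm

/-- The letter `y` starts at the source of the jump `a`. Reading it later would mean a return to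
that object. -/
theorem jumpHom_jump_tail (hN : ClassJ N) {G : Type} [Monoid G] (g : G) {n n' : N} {a : A}
    {v : FreeMonoid A} (ha : ¬ IsLoopLetter ψ (n, a, ψ v * n')) {y : N × A × N} (hy : y.1 = n)
    (hq : ψ (FreeMonoid.of y.2.1) * y.2.2 = ψ (FreeMonoid.of a) * (ψ v * n')) :
    jumpHom ψ g y (shiftMap (n * ψ (FreeMonoid.of a)) n' (transduction ψ v)) = 1 := by
  by_contra hne
  obtain ⟨v₁, b, v₂, rfl, hb⟩ := exists_letter_of_ne_one ψ _ n' v _ hne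
  obtain ⟨rfl, -⟩ := jumpHom_ne_one hb
  simp only at hy hq
  refine ha ?_
  have := not_return hN (ψ := ψ) (n := n) (n' := n') (a := a) (v₁ := v₁)
    (v₂ := FreeMonoid.of b * v₂) hy
    (Eq.trans (by rw [← hq, map_mul, mul_assoc])
      (show ψ (FreeMonoid.of a) * (ψ (v₁ * (FreeMonoid.of b * v₂)) * n') = _ by
        rw [map_mul ψ v₁, mul_assoc]))
  rwa [map_mul, mul_assoc]

theorem baseHom_jump_tail (hN : ClassJ N) (X : KernelCat φ ψ) {n' : N} {a : A} {v : FreeMonoid A}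
    (ha : ¬ IsLoopLetter ψ (X.left, a, ψ v * n'))
    (hq : X.right = ψ (FreeMonoid.of a) * (ψ v * n')) :
    baseHom X (shiftMap (X.left * ψ (FreeMonoid.of a)) n' (transduction ψ v)) = 1 := by
  by_contra hne
  obtain ⟨v₁, b, v₂, rfl, hb⟩ := exists_letter_of_ne_one ψ _ n' v _ hne
  obtain ⟨⟨h1, h2⟩, h3⟩ := baseHom_ne_one hb
  simp only at h1 h2
  have h4 : ψ (FreeMonoid.of b * v₂) * n' = X.right := by
    rw [map_mul, mul_assoc, h2]
    exact h3.2
  refine ha ?_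
  have := not_return hN (ψ := ψ) (n := X.left) (n' := n') (a := a) (v₁ := v₁)
    (v₂ := FreeMonoid.of b * v₂) h1
    ((h4.trans hq).trans (by rw [map_mul ψ v₁, mul_assoc]))
  rwa [map_mul, mul_assoc]

/-- The recorded jumps and loops determine the class of an arrow. -/
theorem map_eq_of_records_eq (hN : ClassJ N) {G : Type} [Monoid G] {g : G} (hg : g ≠ 1)
    (φ : FreeMonoid A →* M) (ψ : FreeMonoid A →* N) (n' : N) (y : FreeMonoid A) (hy : ψ y = n') :
    ∀ (l : ℕ) (v w x : FreeMonoid A) (n : N), v.length ≤ l → ψ x = n →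
      n * ψ v = n * ψ w → ψ v * n' = ψ w * n' →
      (∀ z, jumpHom ψ g z (shiftMap n n' (transduction ψ v)) =
        jumpHom ψ g z (shiftMap n n' (transduction ψ w))) →
      (∀ X : KernelCat φ ψ, baseHom X (shiftMap n n' (transduction ψ v)) =
        baseHom X (shiftMap n n' (transduction ψ w))) →
      φ (x * v * y) = φ (x * w * y) := by
  have loop_case : ∀ (v w x : FreeMonoid A) (n : N), ψ x = n → n * ψ v = n → ψ v * n' = n' →
      n * ψ w = n → ψ w * n' = n' →
      (∀ X : KernelCat φ ψ, baseHom X (shiftMap n n' (transduction ψ v)) =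
        baseHom X (shiftMap n n' (transduction ψ w))) →
      φ (x * v * y) = φ (x * w * y) := by
    intro v w x n hx hv hv' hw hw' hB
    have h := hB ⟨n, n'⟩
    rw [baseHom_loop hN ⟨n, n'⟩ v ⟨hv, hv'⟩, baseHom_loop hN ⟨n, n'⟩ w ⟨hw, hw'⟩,
      loopHom_eq_iff] at h
    exact h x y hx hy
  intro l
  induction l with
  | zero =>
    intro v w x n hl hx hl' hr' hJ hB
    obtain rfl : v = 1 := FreeMonoid.length_eq_zero.1 (Nat.le_zero.1 hl)
    simp only [map_one, mul_one, one_mul] at hl' hr'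
    exact loop_case 1 w x n hx (by simp) (by simp) hl'.symm hr'.symm hB
  | succ l ih =>
    intro v w x n hlen hx hl hr hJ hB
    rcases eq_loop_or_exists_jump ψ n n' v with ⟨h1, h2⟩ | ⟨u, a, v', rfl, hu, hu', ha⟩
    · exact loop_case v w x n hx h1 h2 (hl ▸ h1) (hr ▸ h2) hB
    rcases eq_loop_or_exists_jump ψ n n' w with ⟨h1, h2⟩ | ⟨u', b, w', rfl, hw, hw', hb⟩
    · exact loop_case _ w x n hx (hl.trans h1) (hr.trans h2) h1 h2 hB
    have hq : ψ (FreeMonoid.of a * v') * n' = ψ (FreeMonoid.of b * w') * n' := by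
      rw [← hu', ← hw', hr]
    have hul : ψ u * (ψ (FreeMonoid.of a * v') * n') = ψ (FreeMonoid.of a * v') * n' := by
      conv_rhs => rw [← hu', map_mul, mul_assoc]
    have hwl : ψ u' * (ψ (FreeMonoid.of b * w') * n') = ψ (FreeMonoid.of b * w') * n' := by
      conv_rhs => rw [← hw', map_mul, mul_assoc]
    simp only [transduction_mul_of_mul, map_mul (jumpHom _ _ _), map_mul (baseHom _), hu, hw,
      jumpHom_loop hN g _ hu hul, jumpHom_loop hN g _ hw hwl, one_mul] at hJ hB
    have hqa : ψ (FreeMonoid.of a * v') * n' = ψ (FreeMonoid.of a) * (ψ v' * n') := by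
      rw [map_mul, mul_assoc]
    have hqb : ψ (FreeMonoid.of b * w') * n' = ψ (FreeMonoid.of b) * (ψ w' * n') := by
      rw [map_mul, mul_assoc]
    -- The first jumps have the same source. The recorder of the jump of `v` shows `g ≠ 1` on `v`,
    -- hence on `w`, and the only jump of `w` from this source is its first one.
    have hjump : (n, b, ψ w' * n') = (n, a, ψ v' * n') := by
      have h := hJ (n, a, ψ v' * n')
      rw [jumpHom_self g ha, jumpHom_jump_tail hN g ha rfl rfl, mul_one,
        jumpHom_jump_tail hN g hb rfl (by rw [← hqb, ← hq, hqa]), mul_one] at h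
      exact (jumpHom_ne_one (h ▸ hg)).1
    simp only [Prod.mk.injEq, true_and] at hjump
    obtain ⟨rfl, hvw⟩ := hjump
    have hwl' : ψ u' * (ψ (FreeMonoid.of b * v') * n') = ψ (FreeMonoid.of b * v') * n' := by
      rw [hq]
      exact hwl
    -- The common source of the jumps. The loops at `X` all occur in `u` and in `u'`, so the
    -- recorder at `X` compares exactly these two words.
    let X : KernelCat φ ψ := ⟨n, ψ (FreeMonoid.of b * v') * n'⟩
    have hletter : ∀ Y : KernelCat φ ψ, baseHom Y (FreeMonoid.of (n, b, ψ v' * n')) = 1 := by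
      intro Y
      by_contra hne
      obtain ⟨⟨h1, h2⟩, h3⟩ := baseHom_ne_one hne
      simp only at h1 h2
      exact ha ⟨by simpa only [h1] using h3.1, by simpa only [h2] using h3.2⟩
    have hX1 : baseHom X (shiftMap (n * ψ (FreeMonoid.of b)) n' (transduction ψ v')) = 1 :=
      baseHom_jump_tail hN X ha hqa
    have hX2 : baseHom X (shiftMap (n * ψ (FreeMonoid.of b)) n' (transduction ψ w')) = 1 :=
      baseHom_jump_tail hN X hb (hq.trans hqb)
    have hloops : ∀ v w : FreeMonoid A, ψ v = n → ψ w = X.right →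
        φ (v * u * w) = φ (v * u' * w) := by
      have h := hB X
      rw [hvw, hletter, hX1, hX2, mul_one, mul_one, ← hq, mul_one] at h
      exact (loopHom_eq_iff X _ _).1 ((baseHom_loop hN X u ⟨hu, hul⟩).symm.trans
        (h.trans (baseHom_loop hN X u' ⟨hw, hwl'⟩)))
    have hrest : φ (x * u * FreeMonoid.of b * v' * y) = φ (x * u * FreeMonoid.of b * w' * y) := by
      refine ih v' w' (x * u * FreeMonoid.of b) (n * ψ (FreeMonoid.of b)) ?_ ?_ ?_ hvw.symm ?_ ?_
      · simp only [FreeMonoid.length_mul, FreeMonoid.length_of] at hlen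
        omega
      · simp only [map_mul, hx, hu]
      · simp only [map_mul, ← mul_assoc, hu, hw] at hl
        exact hl
      · intro z
        -- To pass the equality of records to the tails: the jump just made does not recur in either
        -- tail, and every other recorder ignores it.
        by_cases hz : z = (n, b, ψ v' * n')
        · subst hz
          rw [jumpHom_jump_tail hN g ha rfl rfl,
            jumpHom_jump_tail hN g hb rfl (by simp only [hvw])]
        · have h := hJ z
          have h1 : jumpHom ψ g z (FreeMonoid.of (n, b, ψ v' * n')) = 1 := by
            by_contra hne
            exact hz (jumpHom_ne_one hne).1.symm
          rwa [hvw, h1, one_mul, one_mul] at h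
      · intro Y
        by_cases hY : Y = X
        · rw [hY, hX1, hX2]
        · have h := hB Y
          have hne : ∀ u : FreeMonoid A, n * ψ u = n →
              ψ u * (ψ (FreeMonoid.of b * v') * n') = ψ (FreeMonoid.of b * v') * n' →
              baseHom Y (shiftMap n (ψ (FreeMonoid.of b * v') * n') (transduction ψ u)) = 1 := by
            intro u hu hul
            by_contra hne
            obtain ⟨u₁, c, u₂, rfl, hc⟩ := exists_letter_of_ne_one ψ _ _ u n hne
            obtain ⟨⟨h1, h2⟩, -⟩ := baseHom_ne_one hc
            have hu3 : u₁ * (FreeMonoid.of c * u₂) ∈ X.loops := ⟨hu, hul⟩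
            rw [mul_mem_loops_iff hN, mul_mem_loops_iff hN] at hu3
            exact hY (KernelCat.ext (h1.symm.trans hu3.1.1) (h2.symm.trans hu3.2.2.2))
          rwa [hvw, hletter, one_mul, one_mul, ← hq, hne u hu hul, hne u' hw (hwl'), one_mul,
            one_mul] at h
    calc φ (x * (u * (FreeMonoid.of b * v')) * y)
        = φ (x * u * FreeMonoid.of b * v' * y) := by simp only [mul_assoc]
      _ = φ (x * u * FreeMonoid.of b * w' * y) := hrest
      _ = φ (x * u * (FreeMonoid.of b * w' * y)) := by simp only [mul_assoc]
      _ = φ (x * u' * (FreeMonoid.of b * w' * y)) :=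
        hloops x _ hx (by rw [map_mul, hy, ← hq])
      _ = _ := by simp only [mul_assoc]

end KernelCat

/-- All recorders are run in parallel. The nontrivial `G` supplies an element `g ≠ 1` that marks the
occurrence of a jump. -/
theorem FactorsTwoSided.of_baseMonoid_mem {V W : MonoidClass} (hV : IsPseudovariety V)
    {G : Type} [Monoid G] [Nontrivial G] (hG : V G) {A M N : Type} [Finite A] [Monoid M]
    [Monoid N] (hN : ClassJ N) (hW : W N) (φ : FreeMonoid A →* M) (ψ : FreeMonoid A →* N)
    (h : ∀ X : KernelCat φ ψ, V (BaseMonoid X)) : FactorsTwoSided V W φ := by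
  obtain ⟨g, hg⟩ := exists_ne (1 : G)
  have := hN.1
  have : Finite (KernelCat φ ψ) :=
    Finite.of_injective (fun X => (X.left, X.right)) fun X Y h => by
      simp only [Prod.mk.injEq] at h
      exact KernelCat.ext h.1 h.2
  refine ⟨N, _, (N × A × N → G) × (∀ X : KernelCat φ ψ, BaseMonoid X), _, ψ,
    MonoidHom.prod (MonoidHom.pi fun z => KernelCat.jumpHom ψ g z)
      (MonoidHom.pi fun X => KernelCat.baseHom X), hW,
    hV.binary_prod (hV.prod _ _ fun _ => hG) (hV.prod _ _ h), fun v w hψ hh => ?_⟩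
  have s1 : ∀ x : FreeMonoid (N × A × N), shiftMap 1 1 x = x := by
    intro x
    simp only [shiftMap, one_mul, mul_one]
    exact DFunLike.congr_fun FreeMonoid.map_id x
  have := KernelCat.map_eq_of_records_eq hN hg φ ψ 1 1 (map_one ψ) _ v w 1 1 le_rfl (map_one ψ)
    (by rw [hψ]) (by rw [hψ])
    (fun z => by rw [s1, s1]; exact congrFun (congrArg Prod.fst hh) z)
    (fun X => by rw [s1, s1]; exact congrFun (congrArg Prod.snd hh) X)
  simpa using this

/-! ### Closure properties of `V ** J` -/

theorem ClassJ.pi {ι : Type} [Finite ι] {N : ι → Type} [∀ i, Monoid (N i)]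
    (h : ∀ i, ClassJ (N i)) : ClassJ (∀ i, N i) := by
  have := fun i => (h i).1
  refine ClassJ.of_eq_of_mul fun s t a b c d hs ht => funext fun i => ?_
  exact (h i).eq_of_mul (congrFun hs i) (congrFun ht i)

/-- Submonoids are immediate. For quotients, factorizations in `M` need not lift to mutual
divisibility of given preimages, so a preimage generating a minimal ideal is used. -/
theorem ClassJ.of_divides {M N : Type} [Monoid M] [Monoid N] (hN : ClassJ N)
    (h : MonoidDivides M N) : ClassJ M := by
  obtain ⟨S, f, hf⟩ := h
  have := hN.1
  have hS : ∀ s t a b c d : S, s = a * t * b → t = c * s * d → s = t :=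
    fun s t a b c d hs ht => Subtype.ext (hN.eq_of_mul (congrArg Subtype.val hs)
      (congrArg Subtype.val ht))
  have := Finite.of_surjective f hf
  refine ClassJ.of_eq_of_mul fun s t a b c d hs ht => ?_
  let P : Set S := {x | ∃ p q : M, s = p * f x * q}
  let I : S → Set S := fun x => {y | ∃ p q : S, y = p * x * q}
  have hPne : P.Nonempty := by
    obtain ⟨x, rfl⟩ := hf s
    exact ⟨x, 1, 1, by simp⟩
  obtain ⟨x, ⟨p, q, hx⟩, hmin⟩ := (Set.toFinite P).exists_minimalFor I P hPne
  -- If `c * f x * d` still divides `s`, then by minimality its lift generates the same ideal as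
  -- `x`, and `𝒥`-triviality in `S` makes them equal.
  have key : ∀ c d : M, (∃ p q : M, s = p * (c * f x * d) * q) → c * f x * d = f x := by
    rintro c d ⟨p, q, h⟩
    obtain ⟨c, rfl⟩ := hf c
    obtain ⟨d, rfl⟩ := hf d
    have hle : I (c * x * d) ≤ I x := by
      rintro _ ⟨p, q, rfl⟩
      exact ⟨p * c, d * q, by simp only [mul_assoc]⟩
    have hge : I x ≤ I (c * x * d) := hmin ⟨p, q, by rw [h]; simp⟩ hle
    obtain ⟨p', q', h'⟩ := hge (show x ∈ I x from ⟨1, 1, by simp⟩)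
    have : x = c * x * d := hS _ _ p' q' c d h' rfl
    rw [← map_mul, ← map_mul, ← this]
  have h1 : s = f x := by
    rw [hx]
    exact key p q ⟨1, 1, by rw [← hx]; simp⟩
  have h2 : t = f x := by
    rw [ht, h1]
    exact key c d ⟨a, b, by rw [← h1, ← ht, hs]⟩
  rw [h1, h2]

theorem transduction_map {A N N' : Type} [Monoid N] [Monoid N'] (ψ : FreeMonoid A →* N)
    (f : N →* N') (v : FreeMonoid A) :
    FreeMonoid.map (fun x => (f x.1, x.2.1, f x.2.2)) (transduction ψ v) =
      transduction (f.comp ψ) v := by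
  apply FreeMonoid.toList.injective
  simp only [transduction, FreeMonoid.toList_map, FreeMonoid.toList_ofList, List.map_ofFn]
  rfl

theorem TwoSidedProduct.finite {V : MonoidClass} (hV : IsPseudovariety V) {M : Type} [Monoid M]
    (hM : TwoSidedProduct V ClassJ M) : Finite M := by
  obtain ⟨A, _, φ, hφ, N, _, L, _, ψ, h, hN, hL, H⟩ := hM
  have := hN.1
  have := hV.finite L hL
  choose r hr using hφ
  refine Finite.of_injective (fun m => (ψ (r m), h (transduction ψ (r m)))) fun m m' hmm => ?_
  simp only [Prod.mk.injEq] at hmm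
  rw [← hr m, ← hr m', H _ _ hmm.1 hmm.2]

theorem FactorsTwoSided.of_pi {V : MonoidClass} (hV : IsPseudovariety V) {ι : Type} [Finite ι]
    {A : Type} {M : ι → Type} [∀ i, Monoid (M i)] (φ : FreeMonoid A →* ∀ i, M i)
    (h : ∀ i, FactorsTwoSided V ClassJ ((Pi.evalMonoidHom M i).comp φ)) :
    FactorsTwoSided V ClassJ φ := by
  choose N iN L iL ψ h hN hL H using h
  refine ⟨∀ i, N i, inferInstance, ∀ i, L i, inferInstance, MonoidHom.pi ψ,
    MonoidHom.pi fun i => (h i).comp (FreeMonoid.map fun x => (x.1 i, x.2.1, x.2.2 i)),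
    ClassJ.pi hN, hV.prod ι L hL, fun v w h1 h2 => funext fun i => ?_⟩
  refine H i v w (congrFun h1 i) ?_
  have := congrFun h2 i
  simp only [MonoidHom.pi_apply, MonoidHom.comp_apply] at this
  have e : ∀ v, FreeMonoid.map (fun x : (∀ i, N i) × A × (∀ i, N i) => (x.1 i, x.2.1, x.2.2 i))
      (transduction (MonoidHom.pi ψ) v) = transduction (ψ i) v := fun v =>
    transduction_map (MonoidHom.pi ψ) (Pi.evalMonoidHom N i) v
  rwa [e, e] at this

/-- By independence of the alphabet, all factors of a product can be tested on one alphabet, the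
product itself. For a submonoid, the homomorphism is restricted to words over it. -/
theorem TwoSidedProduct.isPseudovariety {V : MonoidClass} (hV : IsPseudovariety V) :
    IsPseudovariety (TwoSidedProduct V ClassJ) where
  finite M _ hM := TwoSidedProduct.finite hV hM
  prod ι _ M _ hM := by
    have := fun i => TwoSidedProduct.finite hV (hM i)
    have hs : Function.Surjective (FreeMonoid.lift (id : (∀ i, M i) → ∀ i, M i)) := fun m =>
      ⟨FreeMonoid.of m, by simp⟩
    refine (twoSidedProduct_iff V ClassJ _ hs).2 (FactorsTwoSided.of_pi hV _ fun i => ?_)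
    refine (twoSidedProduct_iff V ClassJ _ ?_).1 (hM i)
    exact (Function.surjective_eval i).comp hs
  division M N _ _ hN := by
    rintro ⟨S, f, hf⟩
    have := TwoSidedProduct.finite hV hN
    have hs : Function.Surjective (FreeMonoid.lift (id : N → N)) := fun m =>
      ⟨FreeMonoid.of m, by simp⟩
    obtain ⟨N', _, L, _, ψ, h, hN', hL, H⟩ := ((twoSidedProduct_iff V ClassJ _ hs).1 hN).comp
      (FreeMonoid.map (Subtype.val : S → N))
    have hsub : (FreeMonoid.lift (id : N → N)).comp (FreeMonoid.map (Subtype.val : S → N)) =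
        S.subtype.comp (FreeMonoid.lift (id : S → S)) := by
      ext x
      simp
    rw [hsub] at H
    refine ⟨S, inferInstance, f.comp (FreeMonoid.lift id), ?_, N', _, L, _, ψ, h, hN', hL,
      fun v w h1 h2 => congrArg f (Subtype.ext (H v w h1 h2))⟩
    exact hf.comp fun m => ⟨FreeMonoid.of m, by simp⟩

/-- If all monoids of `V` are trivial, then `V ** J = J`. -/
theorem twoSidedProduct_iff_classJ {V : MonoidClass} (hV : IsPseudovariety V)
    (htriv : ∀ (G : Type) [Monoid G], V G → Subsingleton G) (M : Type) [Monoid M] :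
    TwoSidedProduct V ClassJ M ↔ ClassJ M := by
  constructor
  · rintro ⟨A, _, φ, hφ, N, _, L, _, ψ, h, hN, hL, H⟩
    have := htriv L hL
    exact hN.of_divides (.of_factors φ hφ ψ fun v w h => H v w h (Subsingleton.elim _ _))
  · intro hM
    have := hM.1
    exact ⟨M, inferInstance, FreeMonoid.lift id, fun m => ⟨FreeMonoid.of m, by simp⟩, M,
      inferInstance, PUnit, inferInstance, FreeMonoid.lift id, 1, hM, hV.of_subsingleton _,
      fun v w h _ => h⟩

/-- The base monoids of `ker_K φ` decide membership in `V ** J`. -/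
theorem twoSidedProduct_iff_baseMonoid {V : MonoidClass} (hV : IsPseudovariety V) {G : Type}
    [Monoid G] [Nontrivial G] (hG : V G) {A M : Type} [Finite A] [Monoid M] [Finite M]
    (φ : FreeMonoid A →* M) (hφ : Function.Surjective φ) :
    TwoSidedProduct V ClassJ M ↔
      ∀ X : SubwordKernelCat (kernelBound A M) φ, V (BaseMonoid X) := by
  rw [twoSidedProduct_iff V ClassJ φ hφ]
  refine ⟨fun h X => h.baseMonoid_mem hV (kernelBound_ge A M) X, fun h => ?_⟩
  have hJ := subwordCon_quotient_classJ A (kernelBound A M)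
  exact FactorsTwoSided.of_baseMonoid_mem hV hG hJ hJ φ _ h

/-! ### Primitive recursive predicates and functions -/

section Primrec

variable {α β : Type} [Primcodable α] [Primcodable β]

theorem PrimrecPred.imp {p q : α → Prop} (hp : PrimrecPred p) (hq : PrimrecPred q) :
    PrimrecPred fun a => p a → q a :=
  (hp.not.or hq).of_eq fun _ => imp_iff_not_or.symm

theorem PrimrecPred.iff {p q : α → Prop} (hp : PrimrecPred p) (hq : PrimrecPred q) :
    PrimrecPred fun a => (p a ↔ q a) :=
  ((hp.imp hq).and (hq.imp hp)).of_eq fun _ => iff_def.symm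

theorem PrimrecPred.ball {f : α → List β} {R : α → β → Prop} (hf : Primrec f)
    (hR : PrimrecPred fun x : α × β => R x.1 x.2) : PrimrecPred fun a => ∀ x ∈ f a, R a x := by
  have h : PrimrecRel fun (b : β) (a : α) => R a b :=
    (hR.comp (Primrec.snd.pair Primrec.fst) : PrimrecPred fun x : β × α => R x.2 x.1)
  exact h.forall_mem_list.comp hf Primrec.id

theorem PrimrecPred.bex {f : α → List β} {R : α → β → Prop} (hf : Primrec f)
    (hR : PrimrecPred fun x : α × β => R x.1 x.2) : PrimrecPred fun a => ∃ x ∈ f a, R a x := by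
  have h : PrimrecRel fun (b : β) (a : α) => R a b :=
    (hR.comp (Primrec.snd.pair Primrec.fst) : PrimrecPred fun x : β × α => R x.2 x.1)
  exact h.exists_mem_list.comp hf Primrec.id

open Classical in
theorem Primrec.filter {f : α → List β} {R : α → β → Prop} (hf : Primrec f)
    (hR : PrimrecPred fun x : α × β => R x.1 x.2) :
    Primrec fun a => (f a).filter fun x => R a x := by
  have h : PrimrecRel fun (b : β) (a : α) => R a b :=
    (hR.comp (Primrec.snd.pair Primrec.fst) : PrimrecPred fun x : β × α => R x.2 x.1)
  exact h.listFilter.comp hf Primrec.id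

open Classical in
theorem Primrec.findIdx {f : α → List β} {R : α → β → Prop} (hf : Primrec f)
    (hR : PrimrecPred fun x : α × β => R x.1 x.2) :
    Primrec fun a => (f a).findIdx fun x => R a x :=
  Primrec.list_findIdx hf hR.decide

/-- Greedy matching is a fold: the head of the remaining subword is removed whenever it is read, and
success means that nothing remains. -/
theorem Primrec.sublist : PrimrecRel (List.Sublist : List ℕ → List ℕ → Prop) := by
  let strip : List ℕ → List ℕ → List ℕ := fun s u =>
    u.foldl (fun s a => if s.head? = some a then s.tail else s) s
  have hnil : ∀ u, strip [] u = [] := by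
    intro u
    induction u with
    | nil => rfl
    | cons a u ih => simpa [strip] using ih
  have key : ∀ u s : List ℕ, strip s u = [] ↔ s.Sublist u := by
    intro u
    induction u with
    | nil => intro s; simp [strip]
    | cons a u ih =>
      rintro (_ | ⟨b, s⟩)
      · simp [hnil]
      · by_cases hab : b = a
        · subst hab
          rw [List.cons_sublist_cons, ← ih s]
          simp [strip]
        · have : (b :: s).Sublist (a :: u) ↔ (b :: s).Sublist u := by
            constructor
            · intro h
              cases h with
              | cons _ h => exact h
              | cons_cons => exact absurd rfl hab
            · exact fun h => h.cons a
          rw [this, ← ih]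
          simp [strip, hab]
  have hstrip : Primrec₂ strip :=
    Primrec.list_foldl
      (h := fun _ (x : List ℕ × ℕ) => if x.1.head? = some x.2 then x.1.tail else x.1)
      Primrec.snd Primrec.fst
      (Primrec.ite (Primrec.eq.comp (Primrec.list_head?.comp (Primrec.fst.comp Primrec.snd))
        (Primrec.option_some.comp (Primrec.snd.comp Primrec.snd)))
        (Primrec.list_tail.comp (Primrec.fst.comp Primrec.snd)) (Primrec.fst.comp Primrec.snd))
  exact (Primrec.eq.comp hstrip (Primrec.const [])).of_eq fun x => key x.2 x.1

theorem Primrec.tableEntry {t : α → List (List ℕ)} {i j : α → ℕ} (ht : Primrec t)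
    (hi : Primrec i) (hj : Primrec j) : Primrec fun a => _root_.tableEntry (t a) (i a) (j a) :=
  Primrec.option_bind (Primrec.list_getElem?.comp ht hi)
    (Primrec.list_getElem?.comp Primrec.snd (hj.comp Primrec.fst))

end Primrec

/-- The words of length at most `k` over the letters `0, …, n - 1`. -/
def wordsUpTo (n : ℕ) : ℕ → List (List ℕ)
  | 0 => [[]]
  | k + 1 => [] :: (List.range n).flatMap fun a => (wordsUpTo n k).map (a :: ·)

theorem mem_wordsUpTo {n : ℕ} : ∀ {k : ℕ} {u : List ℕ},
    u ∈ wordsUpTo n k ↔ u.length ≤ k ∧ ∀ a ∈ u, a < n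
  | 0, u => by
    simp only [wordsUpTo, List.mem_singleton, Nat.le_zero, List.length_eq_zero_iff]
    exact ⟨fun h => ⟨h, by simp [h]⟩, fun h => h.1⟩
  | k + 1, u => by
    rw [wordsUpTo, List.mem_cons, List.mem_flatMap]
    rcases u with _ | ⟨a, u⟩
    · simp
    · simp [mem_wordsUpTo (k := k), and_left_comm]

theorem Primrec.wordsUpTo : Primrec₂ _root_.wordsUpTo := by
  have h : Primrec₂ fun (n k : ℕ) => Nat.rec (motive := fun _ => List (List ℕ)) [[]]
      (fun _ l => [] :: (List.range n).flatMap fun a => l.map (a :: ·)) k := by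
    refine Primrec.nat_rec (f := fun _ => [[]])
      (g := fun n (x : ℕ × List (List ℕ)) =>
        [] :: (List.range n).flatMap fun a => x.2.map (a :: ·)) (Primrec.const _) ?_
    refine Primrec.list_cons.comp (Primrec.const _) ?_
    refine Primrec.list_flatMap (Primrec.list_range.comp Primrec.fst) ?_
    refine Primrec.list_map (Primrec.snd.comp (Primrec.snd.comp Primrec.fst)) ?_
    exact Primrec.list_cons.comp (Primrec.snd.comp Primrec.fst) Primrec.snd
  refine h.of_eq fun n k => ?_
  induction k with
  | zero => rfl
  | succ k ih => rw [_root_.wordsUpTo, ← ih]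

/-! ### Numbering the classes of a relation -/

open Classical in
/-- Representatives of the classes of the relation `r` that meet the list. -/
noncomputable def classReps {α : Type} (r : α → α → Prop) : List α → List α
  | [] => []
  | a :: l => if ∃ b ∈ classReps r l, r a b then classReps r l else a :: classReps r l

open Classical in
/-- The index of the class of `a`. -/
noncomputable def classIdx {α : Type} (r : α → α → Prop) (l : List α) (a : α) : ℕ :=
  (classReps r l).findIdx fun b => r a b

theorem mem_of_mem_classReps {α : Type} {r : α → α → Prop} {a : α} :
    ∀ {l : List α}, a ∈ classReps r l → a ∈ l
  | [], h => h
  | b :: l, h => by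
    rw [classReps] at h
    split_ifs at h with hb
    · exact List.mem_cons_of_mem _ (mem_of_mem_classReps h)
    · rcases List.mem_cons.1 h with rfl | h
      · exact List.mem_cons_self
      · exact List.mem_cons_of_mem _ (mem_of_mem_classReps h)

theorem exists_mem_classReps {α : Type} {r : α → α → Prop} {a : α} :
    ∀ {l : List α}, (∀ b ∈ l, r b b) → a ∈ l → ∃ b ∈ classReps r l, r a b
  | b :: l, hr, h => by
    rw [classReps]
    split_ifs with hb
    · rcases List.mem_cons.1 h with rfl | h
      · exact hb
      · exact exists_mem_classReps (fun b hb => hr b (List.mem_cons_of_mem _ hb)) h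
    · rcases List.mem_cons.1 h with rfl | h
      · exact ⟨a, List.mem_cons_self, hr a List.mem_cons_self⟩
      · obtain ⟨c, hc, hac⟩ :=
          exists_mem_classReps (fun b hb => hr b (List.mem_cons_of_mem _ hb)) h
        exact ⟨c, List.mem_cons_of_mem _ hc, hac⟩

theorem pairwise_classReps {α : Type} {r : α → α → Prop} :
    ∀ l : List α, (classReps r l).Pairwise fun a b => ¬ r a b
  | [] => List.Pairwise.nil
  | b :: l => by
    rw [classReps]
    split_ifs with hb
    · exact pairwise_classReps l
    · push Not at hb
      exact List.pairwise_cons.2 ⟨hb, pairwise_classReps l⟩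

/-- If the elements of a list represent the elements of `β`, equivalent ones the same element, then
the indices of the classes number `β`. -/
theorem exists_equiv_classIdx {α β : Type} {r : α → α → Prop} {l : List α} {G : α → β → Prop}
    (hl : ∀ a ∈ l, ∃ b, G a b) (hβ : ∀ b, ∃ a ∈ l, G a b)
    (hr : ∀ a a' b b', G a b → G a' b' → (r a a' ↔ b = b')) :
    ∃ e : β ≃ Fin (classReps r l).length,
      (∀ a b, G a b → classIdx r l a = e b) ∧ ∀ b, G (classReps r l)[e b] b := by
  classical
  have hrefl : ∀ a ∈ l, r a a := fun a ha => by
    obtain ⟨b, hb⟩ := hl a ha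
    exact (hr a a b b hb hb).2 rfl
  choose F hF using fun i : Fin (classReps r l).length =>
    hl (classReps r l)[i] (mem_of_mem_classReps (List.getElem_mem i.2))
  have hlt : ∀ i j, i < j → F i ≠ F j := fun i j hij h =>
    List.pairwise_iff_getElem.1 (pairwise_classReps l) i j i.2 j.2 hij
      ((hr _ _ _ _ (hF i) (hF j)).2 h)
  have hinj : Function.Injective F := by
    intro i j h
    by_contra hne
    rcases lt_or_gt_of_ne hne with h' | h'
    exacts [hlt _ _ h' h, hlt _ _ h' h.symm]
  have hsurj : Function.Surjective F := by
    intro b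
    obtain ⟨a, ha, hab⟩ := hβ b
    obtain ⟨c, hc, hac⟩ := exists_mem_classReps hrefl ha
    obtain ⟨i, hi, rfl⟩ := List.getElem_of_mem hc
    exact ⟨⟨i, hi⟩, ((hr _ _ _ _ hab (hF ⟨i, hi⟩)).1 hac).symm⟩
  let e := (Equiv.ofBijective F ⟨hinj, hsurj⟩).symm
  have he : ∀ b, F (e b) = b := fun b => (Equiv.ofBijective F ⟨hinj, hsurj⟩).apply_symm_apply b
  have hG : ∀ b, G (classReps r l)[e b] b := fun b => by
    have := hF (e b)
    rwa [he] at this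
  refine ⟨e, fun a b hab => ?_, hG⟩
  rw [classIdx, List.findIdx_eq (e b).2]
  refine ⟨decide_eq_true ((hr _ _ _ _ hab (hG b)).2 rfl), fun j hj => decide_eq_false fun h => ?_⟩
  have hj' : j < (classReps r l).length := hj.trans (e b).2
  have h1 := (hr _ _ _ _ hab (hF ⟨j, hj'⟩)).1 h
  rw [← he b] at h1
  have h2 := hinj h1
  rw [h2] at hj
  exact lt_irrefl _ hj

section Primrec

variable {α β : Type} [Primcodable α] [Primcodable β]

theorem Primrec.classReps {r : α → β → β → Prop} {f : α → List β} (hf : Primrec f)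
    (hr : PrimrecPred fun x : α × β × β => r x.1 x.2.1 x.2.2) :
    Primrec fun a => _root_.classReps (r a) (f a) := by
  classical
  have hstep : PrimrecPred fun x : α × β × List β => ∃ b ∈ x.2.2, r x.1 x.2.1 b :=
    PrimrecPred.bex (Primrec.snd.comp Primrec.snd)
      (hr.comp ((Primrec.fst.comp Primrec.fst).pair
        ((Primrec.fst.comp (Primrec.snd.comp Primrec.fst)).pair Primrec.snd)))
  have h : Primrec fun a => (f a).foldr
      (fun b l => if ∃ c ∈ l, r a b c then l else b :: l) [] :=
    Primrec.list_foldr (h := fun a (x : β × List β) =>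
        if ∃ c ∈ x.2, r a x.1 c then x.2 else x.1 :: x.2) hf (Primrec.const [])
      (Primrec.ite hstep (Primrec.snd.comp Primrec.snd)
        (Primrec.list_cons.comp (Primrec.fst.comp Primrec.snd) (Primrec.snd.comp Primrec.snd)))
  refine h.of_eq fun a => ?_
  induction f a with
  | nil => rfl
  | cons b l ih => rw [List.foldr_cons, ih, _root_.classReps]

theorem Primrec.classIdx {γ : Type} [Primcodable γ] {r : α → β → β → Prop} {f : α → List β}
    {p : γ → α} {q : γ → β} (hf : Primrec f)
    (hr : PrimrecPred fun x : α × β × β => r x.1 x.2.1 x.2.2) (hp : Primrec p) (hq : Primrec q) :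
    Primrec fun c => _root_.classIdx (r (p c)) (f (p c)) (q c) :=
  Primrec.findIdx ((Primrec.classReps hf hr).comp hp)
    (hr.comp ((hp.comp Primrec.fst).pair ((hq.comp Primrec.fst).pair Primrec.snd)))

end Primrec

/-! ### Short representatives -/

/-- In a long word two prefixes have the same value, and the factor between them can be deleted. -/
theorem exists_short_word {A T : Type} [Monoid T] [Finite T] (θ : FreeMonoid A →* T)
    (x : FreeMonoid A) : ∃ y : FreeMonoid A, y.toList.length < Nat.card T ∧ θ y = θ x := by
  have := Fintype.ofFinite T
  rw [Nat.card_eq_fintype_card]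
  induction hn : x.toList.length using Nat.strong_induction_on generalizing x with
  | _ n ih =>
    by_cases hlt : n < Fintype.card T
    · exact ⟨x, by omega, rfl⟩
    have hni : ¬ Function.Injective fun i : Fin (n + 1) =>
        θ (FreeMonoid.ofList (x.toList.take i)) := fun hi => by
      have := Fintype.card_le_of_injective _ hi
      rw [Fintype.card_fin] at this
      omega
    obtain ⟨i, j, hij, hθ⟩ : ∃ i j : Fin (n + 1), i < j ∧
        θ (FreeMonoid.ofList (x.toList.take i)) = θ (FreeMonoid.ofList (x.toList.take j)) := by
      simp only [Function.Injective] at hni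
      push Not at hni
      obtain ⟨i, j, h1, h2⟩ := hni
      rcases lt_or_gt_of_ne h2 with h | h
      exacts [⟨i, j, h, h1⟩, ⟨j, i, h, h1.symm⟩]
    have hij' : (i : ℕ) < j := hij
    have hj : (j : ℕ) < n + 1 := j.2
    obtain ⟨y, hy1, hy2⟩ := ih (i + (n - j)) (by omega)
      (FreeMonoid.ofList (x.toList.take i ++ x.toList.drop j))
      (by simp only [FreeMonoid.toList_ofList, List.length_append, List.length_take,
            List.length_drop]; omega)
    refine ⟨y, hy1, hy2.trans ?_⟩
    rw [FreeMonoid.ofList_append, map_mul, hθ, ← map_mul, ← FreeMonoid.ofList_append,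
      List.take_append_drop, FreeMonoid.ofList_toList]

/-! ### The code of the kernel category of a multiplication table -/

/-- The product of two elements of a multiplication table. -/
def tableMul (t : List (List ℕ)) (i j : ℕ) : ℕ := (tableEntry t i j).getD 0

/-- `i` is a neutral element of the table. -/
def IsTableOne (t : List (List ℕ)) (i : ℕ) : Prop :=
  ∀ j ∈ List.range t.length, tableEntry t i j = some j ∧ tableEntry t j i = some j

open Classical in
/-- The neutral element of a multiplication table. -/
noncomputable def tableOne (t : List (List ℕ)) : ℕ :=
  (List.range t.length).findIdx fun i => IsTableOne t i

/-- The product of a word of elements of a multiplication table. -/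
noncomputable def tableEval (t : List (List ℕ)) (u : List ℕ) : ℕ :=
  u.foldl (tableMul t) (tableOne t)

/-- The subwords that a multiplication table requires to be compared. -/
def tableTests (t : List (List ℕ)) : List (List ℕ) :=
  wordsUpTo t.length (t.length * ((t.length ^ 2 + t.length) / 2))

/-- Two words have the same subwords among the tests of the table. -/
def TableSubwordEq (t : List (List ℕ)) (u v : List ℕ) : Prop :=
  ∀ s ∈ tableTests t, s.Sublist u ↔ s.Sublist v

/-- Words that represent all pairs of a class of `∼_K` and a value in the monoid. -/
def tableWords (t : List (List ℕ)) : List (List ℕ) :=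
  wordsUpTo t.length (2 ^ (tableTests t).length * t.length)

/-- Equality of the objects represented by pairs of words. -/
def TableObjRel (t : List (List ℕ)) (x y : List ℕ × List ℕ) : Prop :=
  TableSubwordEq t x.1 y.1 ∧ TableSubwordEq t x.2 y.2

/-- Equality of the arrows represented by triples of words, where `(p, u, q)` stands for the arrow
from `(p, uq)` to `(pu, q)` represented by `u`. -/
def TableArrowRel (t : List (List ℕ)) (x y : List ℕ × List ℕ × List ℕ) : Prop :=
  TableObjRel t (x.1, x.2.1 ++ x.2.2) (y.1, y.2.1 ++ y.2.2) ∧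
    TableObjRel t (x.1 ++ x.2.1, x.2.2) (y.1 ++ y.2.1, y.2.2) ∧
    ∀ v ∈ tableWords t, TableSubwordEq t v x.1 → ∀ w ∈ tableWords t, TableSubwordEq t w x.2.2 →
      tableEval t (v ++ x.2.1 ++ w) = tableEval t (v ++ y.2.1 ++ w)

/-- Pairs of words that represent all objects. -/
def tableObjs (t : List (List ℕ)) : List (List ℕ × List ℕ) :=
  (tableWords t).flatMap fun x => (tableWords t).map fun y => (x, y)

/-- Triples of words that represent all arrows. -/
def tableArrows (t : List (List ℕ)) : List (List ℕ × List ℕ × List ℕ) :=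
  (tableWords t).flatMap fun x => (tableObjs t).map fun y => (x, y)

/-- A code of the kernel category of the monoid with the multiplication table `t`. -/
noncomputable def kernelCode (t : List (List ℕ)) : CategoryCode :=
  ((classReps (TableObjRel t) (tableObjs t)).length,
    (classReps (TableArrowRel t) (tableArrows t)).map fun x =>
      (classIdx (TableObjRel t) (tableObjs t) (x.1, x.2.1 ++ x.2.2),
        classIdx (TableObjRel t) (tableObjs t) (x.1 ++ x.2.1, x.2.2)),
    (classReps (TableArrowRel t) (tableArrows t)).map fun x =>
      (classReps (TableArrowRel t) (tableArrows t)).map fun y =>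
        classIdx (TableArrowRel t) (tableArrows t) (x.1, x.2.1 ++ y.2.1, y.2.2))

/-! ### Words over the monoid and their encodings -/

section Correctness

variable {t : List (List ℕ)} {M : Type}

/-- The word of numbers that encodes a word over `M`. -/
def encodeWord (e : M ≃ Fin t.length) (x : FreeMonoid M) : List ℕ :=
  x.toList.map fun m => (e m : ℕ)

theorem encodeWord_mul (e : M ≃ Fin t.length) (x y : FreeMonoid M) :
    encodeWord e (x * y) = encodeWord e x ++ encodeWord e y := by
  simp [encodeWord]

theorem mem_wordsUpTo_length (e : M ≃ Fin t.length) {k : ℕ} {u : List ℕ} :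
    u ∈ wordsUpTo t.length k ↔
      ∃ x : FreeMonoid M, x.toList.length ≤ k ∧ encodeWord e x = u := by
  rw [mem_wordsUpTo]
  constructor
  · rintro ⟨h1, h2⟩
    refine ⟨FreeMonoid.ofList (u.attach.map fun a => e.symm ⟨a.1, h2 a.1 a.2⟩), by simpa using h1,
      ?_⟩
    simp [encodeWord, Function.comp_def]
  · rintro ⟨x, h1, rfl⟩
    refine ⟨by simpa [encodeWord] using h1, fun a ha => ?_⟩
    obtain ⟨m, -, rfl⟩ := List.mem_map.1 ha
    exact (e m).2

theorem encodeWord_sublist (e : M ≃ Fin t.length) (x y : FreeMonoid M) :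
    (encodeWord e x).Sublist (encodeWord e y) ↔ x.toList.Sublist y.toList := by
  have hinj : Function.Injective fun m => (e m : ℕ) := Fin.val_injective.comp e.injective
  refine ⟨fun h => ?_, fun h => h.map _⟩
  obtain ⟨l, hl, h⟩ := List.sublist_map_iff.1 h
  rwa [(List.map_injective_iff.2 hinj) h]

theorem tableSubwordEq_iff (e : M ≃ Fin t.length) (x y : FreeMonoid M) :
    TableSubwordEq t (encodeWord e x) (encodeWord e y) ↔
      (subwordCon M (kernelBound M M)).mk' x = (subwordCon M (kernelBound M M)).mk' y := by
  have hK : t.length * ((t.length ^ 2 + t.length) / 2) = kernelBound M M := by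
    rw [kernelBound, Nat.card_congr e, Nat.card_eq_fintype_card, Fintype.card_fin]
  refine Iff.trans ?_ (subwordCon M (kernelBound M M)).eq.symm
  rw [TableSubwordEq, tableTests, hK]
  constructor
  · intro h s hs
    have := h (encodeWord e (FreeMonoid.ofList s))
      ((mem_wordsUpTo_length e).2 ⟨FreeMonoid.ofList s, by simpa using hs, rfl⟩)
    rwa [encodeWord_sublist, encodeWord_sublist] at this
  · intro h s hs
    obtain ⟨s, hs', rfl⟩ := (mem_wordsUpTo_length e).1 hs
    rw [encodeWord_sublist, encodeWord_sublist]
    exact h _ hs'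

variable [Monoid M]

theorem tableMul_eq {e : M ≃ Fin t.length}
    (he : ∀ x y : M, tableEntry t (e x) (e y) = some (e (x * y) : ℕ)) (x y : M) :
    tableMul t (e x) (e y) = e (x * y) := by
  rw [tableMul, he, Option.getD_some]

theorem isTableOne_iff {e : M ≃ Fin t.length}
    (he : ∀ x y : M, tableEntry t (e x) (e y) = some (e (x * y) : ℕ)) (x : M) :
    IsTableOne t (e x) ↔ x = 1 := by
  constructor
  · intro h
    have := (h (e 1) (List.mem_range.2 (e 1).2)).1
    rw [he, mul_one] at this
    exact e.injective (Fin.ext (Option.some.inj this))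
  · rintro rfl j hj
    obtain ⟨m, hm⟩ := e.surjective ⟨j, List.mem_range.1 hj⟩
    obtain rfl : (e m : ℕ) = j := congrArg Fin.val hm
    rw [he, he, one_mul, mul_one]
    exact ⟨rfl, rfl⟩

theorem tableOne_eq {e : M ≃ Fin t.length}
    (he : ∀ x y : M, tableEntry t (e x) (e y) = some (e (x * y) : ℕ)) :
    tableOne t = e 1 := by
  classical
  have hlt : ((e 1 : Fin t.length) : ℕ) < (List.range t.length).length := by simp
  rw [tableOne, List.findIdx_eq hlt]
  refine ⟨?_, fun j hj => ?_⟩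
  · simpa using (isTableOne_iff he 1).2 rfl
  · obtain ⟨m, hm⟩ := e.surjective ⟨j, hj.trans (e 1).2⟩
    obtain rfl : (e m : ℕ) = j := congrArg Fin.val hm
    simp only [List.getElem_range, decide_eq_false_iff_not, isTableOne_iff he]
    rintro rfl
    exact lt_irrefl _ hj

theorem tableEval_eq {e : M ≃ Fin t.length}
    (he : ∀ x y : M, tableEntry t (e x) (e y) = some (e (x * y) : ℕ)) (x : FreeMonoid M) :
    tableEval t (encodeWord e x) = e (FreeMonoid.lift id x) := by
  have key : ∀ (x : FreeMonoid M) (m : M), (encodeWord e x).foldl (tableMul t) (e m) =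
      e (m * FreeMonoid.lift id x) := by
    intro x
    induction x using FreeMonoid.inductionOn' with
    | one => intro m; simp [encodeWord]
    | of_mul a x ih =>
      intro m
      rw [encodeWord_mul, List.foldl_append, map_mul (FreeMonoid.lift id), ← mul_assoc, ← ih]
      simp [encodeWord, tableMul_eq he]
  rw [tableEval, tableOne_eq he, key, one_mul]

/-- A short word is taken for the pair of homomorphisms `(ψ_K, φ)`. A class of `∼_K` is determined
by the outcomes of the subword tests, which gives the factor `2 ^ (tableTests t).length`. -/
theorem exists_mem_tableWords (e : M ≃ Fin t.length) (x : FreeMonoid M) :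
    ∃ y : FreeMonoid M, encodeWord e y ∈ tableWords t ∧
      (subwordCon M (kernelBound M M)).mk' y = (subwordCon M (kernelBound M M)).mk' x ∧
      FreeMonoid.lift id y = FreeMonoid.lift (id : M → M) x := by
  have : Finite M := Finite.of_equiv _ e.symm
  have := subwordCon_quotient_finite M (kernelBound M M)
  obtain ⟨y, hy, hxy⟩ := exists_short_word
    ((subwordCon M (kernelBound M M)).mk'.prod (FreeMonoid.lift (id : M → M))) x
  have hcard : Nat.card (subwordCon M (kernelBound M M)).Quotient ≤
      2 ^ (tableTests t).length := by
    classical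
    let F : (subwordCon M (kernelBound M M)).Quotient → Fin (tableTests t).length → Bool :=
      fun q => Con.liftOn q
        (fun x i => decide ((tableTests t)[i].Sublist (encodeWord e x))) fun x y h => by
          have h' := (tableSubwordEq_iff e x y).2 ((subwordCon M (kernelBound M M)).eq.2 h)
          exact funext fun i => decide_eq_decide.2 (h' _ (List.getElem_mem _))
    have hF : Function.Injective F := by
      intro p q
      induction p using Con.induction_on with | H x => ?_
      induction q using Con.induction_on with | H y => ?_
      intro h
      refine (tableSubwordEq_iff e x y).1 fun s hs => ?_
      obtain ⟨i, hi, rfl⟩ := List.getElem_of_mem hs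
      exact decide_eq_decide.1 (congrFun h ⟨i, hi⟩)
    have := Nat.card_le_card_of_injective F hF
    simpa using this
  refine ⟨y, (mem_wordsUpTo_length e).2 ⟨y, ?_, rfl⟩, congrArg Prod.fst hxy,
    congrArg Prod.snd hxy⟩
  refine hy.le.trans ?_
  rw [Nat.card_prod, Nat.card_congr e, Nat.card_eq_fintype_card (α := Fin t.length),
    Fintype.card_fin]
  exact Nat.mul_le_mul_right _ hcard

end Correctness

/-! ### Arrows represented by triples of words -/

namespace KernelCat

variable {A M N : Type} [Monoid M] [Monoid N] {φ : FreeMonoid A →* M} {ψ : FreeMonoid A →* N}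

theorem sigma_mk_eq_iff {X Y X' Y' : KernelCat φ ψ} (u : Rep X Y) (u' : Rep X' Y') :
    ((⟨X, Y, Quotient.mk (repSetoid X Y) u⟩ : Σ X Y : KernelCat φ ψ, X ⟶ Y) =
        ⟨X', Y', Quotient.mk (repSetoid X' Y') u'⟩) ↔
      X = X' ∧ Y = Y' ∧ ∀ v w : FreeMonoid A, ψ v = X.left → ψ w = Y.right →
        φ (v * u.1 * w) = φ (v * u'.1 * w) := by
  constructor
  · intro h
    obtain ⟨rfl, h⟩ := Sigma.mk.inj_iff.1 h
    obtain ⟨rfl, h⟩ := Sigma.mk.inj_iff.1 (eq_of_heq h)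
    exact ⟨rfl, rfl, Quotient.exact (eq_of_heq h)⟩
  · rintro ⟨rfl, rfl, h⟩
    have : Quotient.mk (repSetoid X Y) u = Quotient.mk (repSetoid X Y) u' := Quotient.sound h
    rw [this]

/-- The arrow from `(p, uq)` to `(pu, q)` represented by `u`. -/
def arrowOf (φ : FreeMonoid A →* M) (ψ : FreeMonoid A →* N) (p u q : FreeMonoid A) :
    Σ X Y : KernelCat φ ψ, X ⟶ Y :=
  ⟨⟨ψ p, ψ (u * q)⟩, ⟨ψ (p * u), ψ q⟩,
    Quotient.mk (repSetoid _ _) ⟨u, (map_mul ψ p u).symm, (map_mul ψ u q).symm⟩⟩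

theorem mk_eq_arrowOf_iff {X Y : KernelCat φ ψ} (r : Rep X Y) (p u q : FreeMonoid A) :
    (⟨X, Y, Quotient.mk (repSetoid X Y) r⟩ : Σ X Y : KernelCat φ ψ, X ⟶ Y) = arrowOf φ ψ p u q ↔
      X = ⟨ψ p, ψ (u * q)⟩ ∧ Y = ⟨ψ (p * u), ψ q⟩ ∧
        ∀ v w : FreeMonoid A, ψ v = X.left → ψ w = Y.right → φ (v * r.1 * w) = φ (v * u * w) :=
  sigma_mk_eq_iff _ _

/-- The shared middle object gives `ψ q = ψ (u' * q')` and `ψ p' = ψ (p * u)`, so the outer words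
`p` and `q'` fix the ends of the composite. -/
theorem comp_eq_arrowOf {X Y Z : KernelCat φ ψ} (f : X ⟶ Y) (g : Y ⟶ Z)
    {p u q p' u' q' : FreeMonoid A}
    (hf : (⟨X, Y, f⟩ : Σ X Y : KernelCat φ ψ, X ⟶ Y) = arrowOf φ ψ p u q)
    (hg : (⟨Y, Z, g⟩ : Σ X Y : KernelCat φ ψ, X ⟶ Y) = arrowOf φ ψ p' u' q') :
    (⟨X, Z, f ≫ g⟩ : Σ X Y : KernelCat φ ψ, X ⟶ Y) = arrowOf φ ψ p (u * u') q' := by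
  obtain ⟨r, rfl⟩ := Quotient.exists_rep f
  obtain ⟨s, rfl⟩ := Quotient.exists_rep g
  obtain ⟨hX, hY, h1⟩ := (mk_eq_arrowOf_iff r p u q).1 hf
  obtain ⟨hY', hZ, h2⟩ := (mk_eq_arrowOf_iff s p' u' q').1 hg
  have hq : ψ q = ψ (u' * q') := by
    rw [hY] at hY'
    exact congrArg right hY'
  have hp : ψ (p * u) = ψ p' := by
    rw [hY] at hY'
    exact congrArg left hY'
  refine (mk_eq_arrowOf_iff (repMul r s) p (u * u') q').2 ⟨?_, ?_, fun v w hv hw => ?_⟩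
  · rw [hX, map_mul, hq, mul_assoc, map_mul ψ u]
  · rw [hZ, map_mul, ← hp, ← mul_assoc, map_mul ψ (p * u)]
  · have e1 := h1 v (s.1 * w) hv (by rw [map_mul, hw, s.2.2])
    have e2 := h2 (v * u) w (by rw [map_mul, hv, hY, hX, map_mul ψ p]) hw
    simp only [repMul, ← mul_assoc] at e1 e2 ⊢
    exact e1.trans e2

end KernelCat

theorem tableEntry_map {α : Type} {l : List α} (m : α → α → ℕ) {i j : ℕ} {x y : α}
    (hi : l[i]? = some x) (hj : l[j]? = some y) :
    tableEntry (l.map fun x => l.map (m x)) i j = some (m x y) := by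
  simp only [tableEntry, List.getElem?_map, hi, hj, Option.map_some, Option.bind_some]

theorem isCategoryCode_map {C α : Type} [Category.{0, 0} C] {n : ℕ} {l : List α} (o : C ≃ Fin n)
    (a : (Σ X Y : C, (X ⟶ Y)) ≃ Fin l.length) (s : α → ℕ × ℕ) (m : α → α → ℕ)
    (hs : ∀ (X Y : C) (f : X ⟶ Y), s l[a ⟨X, Y, f⟩] = ((o X : ℕ), (o Y : ℕ)))
    (hm : ∀ (X Y Z : C) (f : X ⟶ Y) (g : Y ⟶ Z),
      m l[a ⟨X, Y, f⟩] l[a ⟨Y, Z, g⟩] = (a ⟨X, Z, f ≫ g⟩ : ℕ)) :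
    IsCategoryCode (n, l.map s, l.map fun x => l.map (m x)) C := by
  have hlen : l.length = (l.map s).length := by simp
  refine ⟨o, a.trans (finCongr hlen), fun X Y f => ?_, fun X Y Z f g => ?_⟩
  · rw [← hs]
    exact List.getElem_map _
  · refine Eq.trans ?_ (congrArg some (hm X Y Z f g))
    exact tableEntry_map m (List.getElem?_eq_getElem (a _).2) (List.getElem?_eq_getElem (a _).2)

section Correctness

variable {t : List (List ℕ)} {M : Type} [Monoid M]

open KernelCat

/-- On encoded words the two table relations are equality of objects and equality of arrows, and the
short words reach all of them. Class indices are therefore valid numberings, also for the longer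
words that arise from concatenation. -/
theorem isCategoryCode_kernelCode (h : IsMulTable t M) :
    IsCategoryCode (kernelCode t)
      (SubwordKernelCat (kernelBound M M) (FreeMonoid.lift (id : M → M))) := by
  obtain ⟨-, e, he⟩ := h
  set ψ := (subwordCon M (kernelBound M M)).mk' with hψ
  set φ := FreeMonoid.lift (id : M → M) with hφ
  have hsub := tableSubwordEq_iff e
  rw [← hψ] at hsub
  have hmk : Function.Surjective ψ := Con.mk'_surjective
  have hwords : ∀ u ∈ tableWords t, ∃ x : FreeMonoid M, encodeWord e x = u := fun u hu =>
    let ⟨x, _, hx⟩ := (mem_wordsUpTo_length e).1 hu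
    ⟨x, hx⟩
  have hobj : ∀ p q p' q' : FreeMonoid M,
      TableObjRel t (encodeWord e p, encodeWord e q) (encodeWord e p', encodeWord e q') ↔
        (⟨ψ p, ψ q⟩ : KernelCat φ ψ) = ⟨ψ p', ψ q'⟩ := by
    intro p q p' q'
    rw [KernelCat.mk.injEq, ← hsub, ← hsub]
    rfl
  have harr : ∀ p u q p' u' q' : FreeMonoid M,
      TableArrowRel t (encodeWord e p, encodeWord e u, encodeWord e q)
        (encodeWord e p', encodeWord e u', encodeWord e q') ↔
        arrowOf φ ψ p u q = arrowOf φ ψ p' u' q' := by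
    intro p u q p' u' q'
    rw [TableArrowRel]
    simp only [← encodeWord_mul]
    rw [hobj, hobj]
    refine Iff.trans ?_ (mk_eq_arrowOf_iff _ p' u' q').symm
    refine and_congr_right fun _ => and_congr_right fun _ => ⟨fun h v w hv hw => ?_, ?_⟩
    -- An arbitrary context may be replaced by a short one with the same class and the same value in
    -- `M`.
    · obtain ⟨v', hv1, hv2, hv3⟩ := exists_mem_tableWords e v
      obtain ⟨w', hw1, hw2, hw3⟩ := exists_mem_tableWords e w
      have := h _ hv1 ((hsub _ _).2 (hv2.trans hv)) _ hw1 ((hsub _ _).2 (hw2.trans hw))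
      simp only [← encodeWord_mul, tableEval_eq he] at this
      have := e.injective (Fin.ext this)
      simpa only [map_mul, hv3, hw3] using this
    · intro h v hv hvp w hw hwq
      obtain ⟨v, rfl⟩ := hwords v hv
      obtain ⟨w, rfl⟩ := hwords w hw
      simp only [← encodeWord_mul, tableEval_eq he]
      rw [h v w ((hsub _ _).1 hvp) ((hsub _ _).1 hwq)]
  obtain ⟨o, ho, -⟩ := exists_equiv_classIdx (r := TableObjRel t) (l := tableObjs t)
    (G := fun a (X : KernelCat φ ψ) => ∃ p q : FreeMonoid M,
      a = (encodeWord e p, encodeWord e q) ∧ X = ⟨ψ p, ψ q⟩) (by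
      intro a ha
      simp only [tableObjs, List.mem_flatMap, List.mem_map] at ha
      obtain ⟨x, hx, y, hy, rfl⟩ := ha
      obtain ⟨p, rfl⟩ := hwords x hx
      obtain ⟨q, rfl⟩ := hwords y hy
      exact ⟨_, p, q, rfl, rfl⟩) (by
      rintro ⟨x, y⟩
      obtain ⟨x, rfl⟩ := hmk x
      obtain ⟨y, rfl⟩ := hmk y
      obtain ⟨p, hp1, hp2, -⟩ := exists_mem_tableWords e x
      obtain ⟨q, hq1, hq2, -⟩ := exists_mem_tableWords e y
      refine ⟨(encodeWord e p, encodeWord e q), ?_, p, q, rfl, ?_⟩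
      · simp only [tableObjs, List.mem_flatMap, List.mem_map]
        exact ⟨_, hp1, _, hq1, rfl⟩
      · rw [← hψ] at hp2 hq2
        rw [hp2, hq2]) (by
      rintro _ _ _ _ ⟨p, q, rfl, rfl⟩ ⟨p', q', rfl, rfl⟩
      exact hobj p q p' q')
  obtain ⟨a, ha, hrep⟩ := exists_equiv_classIdx (r := TableArrowRel t) (l := tableArrows t)
    (G := fun a (f : Σ X Y : KernelCat φ ψ, X ⟶ Y) => ∃ p u q : FreeMonoid M,
      a = (encodeWord e p, encodeWord e u, encodeWord e q) ∧ f = arrowOf φ ψ p u q) (by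
      intro a ha
      simp only [tableArrows, tableObjs, List.mem_flatMap, List.mem_map] at ha
      obtain ⟨x, hx, _, ⟨y, hy, z, hz, rfl⟩, rfl⟩ := ha
      obtain ⟨p, rfl⟩ := hwords x hx
      obtain ⟨u, rfl⟩ := hwords y hy
      obtain ⟨q, rfl⟩ := hwords z hz
      exact ⟨_, p, u, q, rfl, rfl⟩) (by
      rintro ⟨X, Y, f⟩
      obtain ⟨r, rfl⟩ := Quotient.exists_rep f
      obtain ⟨x, hx⟩ := hmk X.left
      obtain ⟨y, hy⟩ := hmk Y.right
      obtain ⟨p, hp1, hp2, -⟩ := exists_mem_tableWords e x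
      obtain ⟨u, hu1, hu2, hu3⟩ := exists_mem_tableWords e r.1
      obtain ⟨q, hq1, hq2, -⟩ := exists_mem_tableWords e y
      rw [← hψ] at hp2 hu2 hq2
      refine ⟨(encodeWord e p, encodeWord e u, encodeWord e q), ?_, p, u, q, rfl, ?_⟩
      · simp only [tableArrows, tableObjs, List.mem_flatMap, List.mem_map]
        exact ⟨_, hp1, _, ⟨_, hu1, _, hq1, rfl⟩, rfl⟩
      · refine (mk_eq_arrowOf_iff r p u q).2 ⟨?_, ?_, fun v w _ _ => ?_⟩
        · rw [map_mul, hp2, hu2, hq2, hx, hy, r.2.2]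
        · rw [map_mul, hp2, hu2, hq2, hx, hy, r.2.1]
        · rw [← hφ] at hu3
          simp only [map_mul, hu3]) (by
      rintro _ _ _ _ ⟨p, u, q, rfl, rfl⟩ ⟨p', u', q', rfl, rfl⟩
      exact harr p u q p' u' q')
  refine isCategoryCode_map o a _ _ (fun X Y f => ?_) (fun X Y Z f g => ?_)
  · obtain ⟨p, u, q, hpuq, hf⟩ := hrep ⟨X, Y, f⟩
    obtain ⟨rfl, hf⟩ := Sigma.mk.inj_iff.1 hf
    obtain ⟨rfl, -⟩ := Sigma.mk.inj_iff.1 (eq_of_heq hf)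
    rw [hpuq, ← ho (encodeWord e p, encodeWord e (u * q)) _ ⟨p, u * q, rfl, rfl⟩,
      ← ho (encodeWord e (p * u), encodeWord e q) _ ⟨p * u, q, rfl, rfl⟩, encodeWord_mul,
      encodeWord_mul]
  · obtain ⟨p, u, q, hpuq, hf⟩ := hrep ⟨X, Y, f⟩
    obtain ⟨p', u', q', hpuq', hg⟩ := hrep ⟨Y, Z, g⟩
    rw [hpuq, hpuq', ← encodeWord_mul]
    exact ha _ ⟨X, Z, f ≫ g⟩ ⟨p, u * u', q', rfl, comp_eq_arrowOf f g hf hg⟩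

end Correctness

/-! ### The code is computable -/

section Primrec

variable {α : Type} [Primcodable α]

theorem Primrec.tableMul {t : α → List (List ℕ)} {i j : α → ℕ} (ht : Primrec t)
    (hi : Primrec i) (hj : Primrec j) : Primrec fun a => _root_.tableMul (t a) (i a) (j a) :=
  Primrec.option_getD.comp (Primrec.tableEntry ht hi hj) (Primrec.const 0)

theorem PrimrecPred.isTableOne {t : α → List (List ℕ)} {i : α → ℕ} (ht : Primrec t)
    (hi : Primrec i) : PrimrecPred fun a => IsTableOne (t a) (i a) := by
  have ht' := ht.comp (Primrec.fst (α := α) (β := ℕ))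
  have hi' := hi.comp (Primrec.fst (α := α) (β := ℕ))
  have hj := Primrec.option_some.comp (Primrec.snd (α := α) (β := ℕ))
  exact PrimrecPred.ball (Primrec.list_range.comp (Primrec.list_length.comp ht))
    ((Primrec.eq.comp (Primrec.tableEntry ht' hi' Primrec.snd) hj).and
      (Primrec.eq.comp (Primrec.tableEntry ht' Primrec.snd hi') hj))

theorem Primrec.tableOne : Primrec _root_.tableOne :=
  Primrec.findIdx (Primrec.list_range.comp Primrec.list_length)
    (PrimrecPred.isTableOne Primrec.fst Primrec.snd)

theorem Primrec.tableEval {t : α → List (List ℕ)} {u : α → List ℕ} (ht : Primrec t)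
    (hu : Primrec u) : Primrec fun a => _root_.tableEval (t a) (u a) :=
  Primrec.list_foldl (h := fun a (x : ℕ × ℕ) => _root_.tableMul (t a) x.1 x.2) hu
    (Primrec.tableOne.comp ht)
    (Primrec.tableMul (ht.comp Primrec.fst) (Primrec.fst.comp Primrec.snd)
      (Primrec.snd.comp Primrec.snd))

theorem Primrec.nat_pow : Primrec₂ ((· ^ ·) : ℕ → ℕ → ℕ) :=
  Primrec₂.unpaired'.1 Nat.Primrec.pow

theorem Primrec.tableTests : Primrec _root_.tableTests := by
  have h : Primrec fun t : List (List ℕ) => t.length := Primrec.list_length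
  exact Primrec.wordsUpTo.comp h (Primrec.nat_mul.comp h (Primrec.nat_div.comp
    (Primrec.nat_add.comp (Primrec.nat_pow.comp h (Primrec.const 2)) h) (Primrec.const 2)))

theorem Primrec.tableWords : Primrec _root_.tableWords :=
  Primrec.wordsUpTo.comp Primrec.list_length (Primrec.nat_mul.comp
    (Primrec.nat_pow.comp (Primrec.const 2) (Primrec.list_length.comp Primrec.tableTests))
    Primrec.list_length)

theorem PrimrecPred.tableSubwordEq {t : α → List (List ℕ)} {u v : α → List ℕ} (ht : Primrec t)
    (hu : Primrec u) (hv : Primrec v) : PrimrecPred fun a => TableSubwordEq (t a) (u a) (v a) :=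
  PrimrecPred.ball (Primrec.tableTests.comp ht)
    ((Primrec.sublist.comp Primrec.snd (hu.comp Primrec.fst)).iff
      (Primrec.sublist.comp Primrec.snd (hv.comp Primrec.fst)))

theorem PrimrecPred.tableObjRel {t : α → List (List ℕ)} {x y : α → List ℕ × List ℕ}
    (ht : Primrec t) (hx : Primrec x) (hy : Primrec y) :
    PrimrecPred fun a => TableObjRel (t a) (x a) (y a) :=
  (PrimrecPred.tableSubwordEq ht (Primrec.fst.comp hx) (Primrec.fst.comp hy)).and
    (PrimrecPred.tableSubwordEq ht (Primrec.snd.comp hx) (Primrec.snd.comp hy))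

theorem Primrec.arrowSource {x : α → List ℕ × List ℕ × List ℕ} (hx : Primrec x) :
    Primrec fun a => ((x a).1, (x a).2.1 ++ (x a).2.2) :=
  (Primrec.fst.comp hx).pair (Primrec.list_append.comp
    (Primrec.fst.comp (Primrec.snd.comp hx)) (Primrec.snd.comp (Primrec.snd.comp hx)))

theorem Primrec.arrowTarget {x : α → List ℕ × List ℕ × List ℕ} (hx : Primrec x) :
    Primrec fun a => ((x a).1 ++ (x a).2.1, (x a).2.2) :=
  (Primrec.list_append.comp (Primrec.fst.comp hx) (Primrec.fst.comp (Primrec.snd.comp hx))).pair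
    (Primrec.snd.comp (Primrec.snd.comp hx))

theorem PrimrecPred.tableArrowRel {t : α → List (List ℕ)} {x y : α → List ℕ × List ℕ × List ℕ}
    (ht : Primrec t) (hx : Primrec x) (hy : Primrec y) :
    PrimrecPred fun a => TableArrowRel (t a) (x a) (y a) := by
  refine (PrimrecPred.tableObjRel ht (.arrowSource hx) (.arrowSource hy)).and
    ((PrimrecPred.tableObjRel ht (.arrowTarget hx) (.arrowTarget hy)).and
    (PrimrecPred.ball (Primrec.tableWords.comp ht) (PrimrecPred.imp
      (PrimrecPred.tableSubwordEq (ht.comp Primrec.fst) Primrec.snd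
        (Primrec.fst.comp (hx.comp Primrec.fst)))
      (PrimrecPred.ball (Primrec.tableWords.comp (ht.comp Primrec.fst)) (PrimrecPred.imp
        (PrimrecPred.tableSubwordEq (ht.comp (Primrec.fst.comp Primrec.fst)) Primrec.snd
          (Primrec.snd.comp (Primrec.snd.comp (hx.comp (Primrec.fst.comp Primrec.fst))))) ?_)))))
  have ht' : Primrec fun b : (α × List ℕ) × List ℕ => t b.1.1 :=
    ht.comp (Primrec.fst.comp Primrec.fst)
  have heval : ∀ {z : α → List ℕ × List ℕ × List ℕ}, Primrec z →
      Primrec fun b : (α × List ℕ) × List ℕ =>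
        _root_.tableEval (t b.1.1) (b.1.2 ++ (z b.1.1).2.1 ++ b.2) := fun {z} hz =>
    Primrec.tableEval ht' (Primrec.list_append.comp (Primrec.list_append.comp
      (Primrec.snd.comp Primrec.fst)
      (Primrec.fst.comp (Primrec.snd.comp (hz.comp (Primrec.fst.comp Primrec.fst)))))
      Primrec.snd)
  exact Primrec.eq.comp (heval hx) (heval hy)

theorem Primrec.tableObjs : Primrec _root_.tableObjs :=
  Primrec.list_flatMap Primrec.tableWords (Primrec.list_map (Primrec.tableWords.comp Primrec.fst)
    ((Primrec.snd.comp Primrec.fst).pair Primrec.snd))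

theorem Primrec.tableArrows : Primrec _root_.tableArrows :=
  Primrec.list_flatMap Primrec.tableWords (Primrec.list_map (Primrec.tableObjs.comp Primrec.fst)
    ((Primrec.snd.comp Primrec.fst).pair Primrec.snd))

theorem Primrec.kernelCode : Primrec _root_.kernelCode := by
  have hobj : PrimrecPred fun x : List (List ℕ) × (List ℕ × List ℕ) × (List ℕ × List ℕ) =>
      TableObjRel x.1 x.2.1 x.2.2 :=
    PrimrecPred.tableObjRel Primrec.fst (Primrec.fst.comp Primrec.snd)
      (Primrec.snd.comp Primrec.snd)
  have harr : PrimrecPred fun x : List (List ℕ) × (List ℕ × List ℕ × List ℕ) ×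
      (List ℕ × List ℕ × List ℕ) => TableArrowRel x.1 x.2.1 x.2.2 :=
    PrimrecPred.tableArrowRel Primrec.fst (Primrec.fst.comp Primrec.snd)
      (Primrec.snd.comp Primrec.snd)
  have hO := Primrec.classReps (r := TableObjRel) Primrec.tableObjs hobj
  have hA := Primrec.classReps (r := TableArrowRel) Primrec.tableArrows harr
  refine (Primrec.list_length.comp hO).pair (Primrec.pair (Primrec.list_map hA ?_)
    (Primrec.list_map hA (Primrec.list_map (hA.comp Primrec.fst) ?_)))
  · exact (Primrec.classIdx Primrec.tableObjs hobj Primrec.fst (.arrowSource Primrec.snd)).pair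
      (Primrec.classIdx Primrec.tableObjs hobj Primrec.fst (.arrowTarget Primrec.snd))
  · refine Primrec.classIdx Primrec.tableArrows harr (Primrec.fst.comp Primrec.fst) ?_
    exact (Primrec.fst.comp (Primrec.snd.comp Primrec.fst)).pair ((Primrec.list_append.comp
      (Primrec.fst.comp (Primrec.snd.comp (Primrec.snd.comp Primrec.fst)))
      (Primrec.fst.comp (Primrec.snd.comp Primrec.snd))).pair
      (Primrec.snd.comp (Primrec.snd.comp Primrec.snd)))

/-! ### Base monoids read off from a category code -/

/-- The numbers of the arrows from the object `i` to itself. -/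
def codeLoops (c : CategoryCode) (i : ℕ) : List ℕ :=
  (List.range c.2.1.length).filter fun k => c.2.1[k]? = some (i, i)

/-- The multiplication table of the base monoid at the object `i`. -/
def codeBaseTable (c : CategoryCode) (i : ℕ) : List (List ℕ) :=
  (codeLoops c i).map fun k => (codeLoops c i).map fun l =>
    (codeLoops c i).idxOf (tableMul c.2.2 k l)

theorem Primrec.codeLoops : Primrec₂ _root_.codeLoops := by
  have h : PrimrecPred fun x : (CategoryCode × ℕ) × ℕ =>
      x.1.1.2.1[x.2]? = some (x.1.2, x.1.2) :=
    Primrec.eq.comp (Primrec.list_getElem?.comp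
      (Primrec.fst.comp (Primrec.snd.comp (Primrec.fst.comp Primrec.fst))) Primrec.snd)
      (Primrec.option_some.comp ((Primrec.snd.comp Primrec.fst).pair
        (Primrec.snd.comp Primrec.fst)))
  refine (Primrec.filter (f := fun x : CategoryCode × ℕ => List.range x.1.2.1.length)
    (R := fun x k => x.1.2.1[k]? = some (x.2, x.2))
    (Primrec.list_range.comp (Primrec.list_length.comp
      (Primrec.fst.comp (Primrec.snd.comp Primrec.fst)))) h).of_eq fun x => ?_
  simp only [_root_.codeLoops]
  congr!

theorem Primrec.codeBaseTable : Primrec₂ _root_.codeBaseTable := by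
  have h : Primrec fun x : CategoryCode × ℕ => _root_.codeLoops x.1 x.2 := Primrec.codeLoops
  refine Primrec.list_map h (Primrec.list_map (h.comp Primrec.fst)
    (Primrec.list_idxOf.comp ?_ (h.comp (Primrec.fst.comp Primrec.fst))))
  exact Primrec.tableMul
    (Primrec.snd.comp (Primrec.snd.comp (Primrec.fst.comp (Primrec.fst.comp Primrec.fst))))
    (Primrec.snd.comp Primrec.fst) Primrec.snd

end Primrec

theorem IsCategoryCode.isMulTable_codeBaseTable {c : CategoryCode} {C : Type} [Category.{0, 0} C]
    (o : C ≃ Fin c.1) (a : (Σ X Y : C, (X ⟶ Y)) ≃ Fin c.2.1.length)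
    (ha : ∀ (X Y : C) (f : X ⟶ Y), c.2.1[a ⟨X, Y, f⟩] = ((o X : ℕ), (o Y : ℕ)))
    (hm : ∀ (X Y Z : C) (f : X ⟶ Y) (g : Y ⟶ Z),
      tableEntry c.2.2 (a ⟨X, Y, f⟩) (a ⟨Y, Z, g⟩) = some (a ⟨X, Z, f ≫ g⟩ : ℕ)) (X : C) :
    IsMulTable (codeBaseTable c (o X)) (BaseMonoid X) := by
  have hmem : ∀ k, k ∈ codeLoops c (o X) ↔ ∃ f : X ⟶ X, (a ⟨X, X, f⟩ : ℕ) = k := by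
    intro k
    simp only [codeLoops, List.mem_filter, List.mem_range, decide_eq_true_eq]
    constructor
    · rintro ⟨hk, h⟩
      obtain ⟨⟨Y, Z, f⟩, hf⟩ := a.surjective ⟨k, hk⟩
      obtain rfl : (a ⟨Y, Z, f⟩ : ℕ) = k := congrArg Fin.val hf
      have h1 := ha Y Z f
      rw [List.getElem?_eq_getElem hk] at h
      have h2 := (Option.some.inj h).symm.trans h1
      simp only [Prod.mk.injEq] at h2
      obtain rfl := o.injective (Fin.ext h2.1)
      obtain rfl := o.injective (Fin.ext h2.2)
      exact ⟨f, rfl⟩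
    · rintro ⟨f, rfl⟩
      exact ⟨(a _).2, (List.getElem?_eq_getElem (a _).2).trans (congrArg some (ha X X f))⟩
  have hnd : (codeLoops c (o X)).Nodup := List.nodup_range.filter _
  let F : BaseMonoid X → {k // k ∈ codeLoops c (o X)} := fun f =>
    ⟨a ⟨X, X, f⟩, (hmem _).2 ⟨f, rfl⟩⟩
  have hF : Function.Bijective F := by
    constructor
    · intro f g h
      have h1 := a.injective (Fin.ext (congrArg Subtype.val h))
      have h2 := (Sigma.mk.inj_iff.1 h1).2
      exact eq_of_heq (Sigma.mk.inj_iff.1 (eq_of_heq h2)).2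
    · rintro ⟨k, hk⟩
      obtain ⟨f, rfl⟩ := (hmem k).1 hk
      exact ⟨f, rfl⟩
  have hlen : (codeLoops c (o X)).length = (codeBaseTable c (o X)).length := by
    simp [codeBaseTable]
  let e := ((Equiv.ofBijective F hF).trans
    (List.Nodup.getEquiv (codeLoops c (o X)) hnd).symm).trans (finCongr hlen)
  have he : ∀ f : BaseMonoid X, (e f : ℕ) = (codeLoops c (o X)).idxOf (a ⟨X, X, f⟩ : ℕ) :=
    fun f => rfl
  have hget : ∀ f : BaseMonoid X, (codeLoops c (o X))[(e f : ℕ)]? = some (a ⟨X, X, f⟩ : ℕ) := by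
    intro f
    rw [he]
    exact List.getElem?_idxOf ((hmem _).2 ⟨f, rfl⟩)
  refine ⟨?_, e, fun f g => ?_⟩
  · intro row hrow
    obtain ⟨k, -, rfl⟩ := List.mem_map.1 hrow
    simp [codeBaseTable]
  · refine (tableEntry_map (fun k l => (codeLoops c (o X)).idxOf (tableMul c.2.2 k l))
      (hget f) (hget g)).trans (congrArg some ?_)
    rw [he, tableMul]
    exact congrArg (fun z => (codeLoops c (o X)).idxOf (z.getD 0)) (hm X X X f g)

/-! ### Recognizing multiplication tables -/

/-- The conditions under which a table is a multiplication table of a monoid. -/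
def IsMonoidTable (t : List (List ℕ)) : Prop :=
  (∀ row ∈ t, row.length = t.length ∧ ∀ x ∈ row, x < t.length) ∧
    (∃ i ∈ List.range t.length, IsTableOne t i) ∧
    ∀ i ∈ List.range t.length, ∀ j ∈ List.range t.length, ∀ k ∈ List.range t.length,
      tableMul t (tableMul t i j) k = tableMul t i (tableMul t j k)

theorem IsMulTable.isMonoidTable {t : List (List ℕ)} {M : Type} [Monoid M]
    (h : IsMulTable t M) : IsMonoidTable t := by
  obtain ⟨hrow, e, he⟩ := h
  have hsurj : ∀ i ∈ List.range t.length, ∃ x, (e x : ℕ) = i := fun i hi => by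
    obtain ⟨x, hx⟩ := e.surjective ⟨i, List.mem_range.1 hi⟩
    exact ⟨x, congrArg Fin.val hx⟩
  refine ⟨fun row hr => ⟨hrow row hr, fun x hx => ?_⟩,
    ⟨e 1, List.mem_range.2 (e 1).2, (isTableOne_iff he 1).2 rfl⟩, ?_⟩
  · obtain ⟨i, hi, rfl⟩ := List.getElem_of_mem hr
    obtain ⟨j, hj, rfl⟩ := List.getElem_of_mem hx
    obtain ⟨x, rfl⟩ := hsurj i (List.mem_range.2 hi)
    obtain ⟨y, rfl⟩ := hsurj j (List.mem_range.2 (hj.trans_eq (hrow _ hr)))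
    have := he x y
    rw [tableEntry, List.getElem?_eq_getElem hi, Option.bind_some,
      List.getElem?_eq_getElem hj] at this
    rw [Option.some.inj this]
    exact (e (x * y)).2
  · intro i hi j hj k hk
    obtain ⟨x, rfl⟩ := hsurj i hi
    obtain ⟨y, rfl⟩ := hsurj j hj
    obtain ⟨z, rfl⟩ := hsurj k hk
    simp only [tableMul_eq he, mul_assoc]

theorem IsMonoidTable.exists_isMulTable {t : List (List ℕ)} (h : IsMonoidTable t) :
    ∃ (M : Type) (_ : Monoid M), IsMulTable t M := by
  obtain ⟨hrow, ⟨i, hi, hone⟩, hassoc⟩ := h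
  have hentry : ∀ x y : Fin t.length, ∃ z : Fin t.length, tableEntry t x y = some (z : ℕ) := by
    intro x y
    have hx : t[(x : ℕ)] ∈ t := List.getElem_mem x.2
    have hy : (y : ℕ) < t[(x : ℕ)].length := by
      rw [(hrow _ hx).1]
      exact y.2
    refine ⟨⟨t[(x : ℕ)][(y : ℕ)], (hrow _ hx).2 _ (List.getElem_mem hy)⟩, ?_⟩
    rw [tableEntry, List.getElem?_eq_getElem x.2, Option.bind_some, List.getElem?_eq_getElem hy]
  choose m hm using hentry
  have hm' : ∀ x y : Fin t.length, tableMul t x y = m x y := fun x y => by rw [tableMul, hm, Option.getD_some]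
  have hr : ∀ x : Fin t.length, (x : ℕ) ∈ List.range t.length := fun x => List.mem_range.2 x.2
  let M : Monoid (Fin t.length) :=
    { mul := m
      one := ⟨i, List.mem_range.1 hi⟩
      mul_assoc := fun x y z => Fin.ext (by
        have := hassoc x (hr x) y (hr y) z (hr z)
        simp only [hm'] at this
        exact this)
      one_mul := fun x => Fin.ext (Option.some.inj
        ((hm ⟨i, List.mem_range.1 hi⟩ x).symm.trans (hone x (hr x)).1))
      mul_one := fun x => Fin.ext (Option.some.inj
        ((hm x ⟨i, List.mem_range.1 hi⟩).symm.trans (hone x (hr x)).2)) }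
  exact ⟨Fin t.length, M, fun row h => (hrow row h).1, Equiv.refl _, fun x y => hm x y⟩

theorem IsMulTable.nonempty_mulEquiv {t : List (List ℕ)} {M N : Type} [Monoid M] [Monoid N]
    (hM : IsMulTable t M) (hN : IsMulTable t N) : Nonempty (M ≃* N) := by
  obtain ⟨-, e, he⟩ := hM
  obtain ⟨-, e', he'⟩ := hN
  refine ⟨{ e.trans e'.symm with map_mul' := fun x y => ?_ }⟩
  have h1 := he' (e'.symm (e x)) (e'.symm (e y))
  simp only [Equiv.apply_symm_apply, he] at h1
  apply e'.injective
  simpa using Fin.ext (Option.some.inj h1)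

/-- A table determines its monoid up to isomorphism, so any monoid with that table can be tested. -/
theorem IsPseudovariety.mem_iff_of_isMulTable {V : MonoidClass} (hV : IsPseudovariety V)
    {t : List (List ℕ)} {M : Type} [Monoid M] (hM : IsMulTable t M) :
    (∃ (N : Type) (_ : Monoid N), IsMulTable t N ∧ V N) ↔ V M := by
  constructor
  · rintro ⟨N, _, hN, h⟩
    obtain ⟨e⟩ := hN.nonempty_mulEquiv hM
    exact hV.of_mulEquiv e h
  · exact fun h => ⟨M, _, hM, h⟩

theorem PrimrecPred.isMonoidTable : PrimrecPred IsMonoidTable := by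
  have hr : ∀ {α : Type} [Primcodable α] {t : α → List (List ℕ)}, Primrec t →
      Primrec fun a => List.range (t a).length := fun ht =>
    Primrec.list_range.comp (Primrec.list_length.comp ht)
  refine PrimrecPred.and (PrimrecPred.ball Primrec.id (PrimrecPred.and ?_ ?_))
    (PrimrecPred.and (PrimrecPred.bex (hr Primrec.id)
      (PrimrecPred.isTableOne Primrec.fst Primrec.snd))
    (PrimrecPred.ball (hr Primrec.id) (PrimrecPred.ball (hr Primrec.fst)
      (PrimrecPred.ball (hr (Primrec.fst.comp Primrec.fst)) ?_))))
  · exact Primrec.eq.comp (Primrec.list_length.comp Primrec.snd)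
      (Primrec.list_length.comp Primrec.fst)
  · exact PrimrecPred.ball Primrec.snd (Primrec.nat_lt.comp Primrec.snd
      (Primrec.list_length.comp (Primrec.fst.comp Primrec.fst)))
  · have ht := (Primrec.fst.comp (Primrec.fst.comp Primrec.fst) :
      Primrec fun x : ((List (List ℕ) × ℕ) × ℕ) × ℕ => x.1.1.1)
    have hi := (Primrec.snd.comp (Primrec.fst.comp Primrec.fst) :
      Primrec fun x : ((List (List ℕ) × ℕ) × ℕ) × ℕ => x.1.1.2)
    have hj := (Primrec.snd.comp Primrec.fst :
      Primrec fun x : ((List (List ℕ) × ℕ) × ℕ) × ℕ => x.1.2)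
    exact Primrec.eq.comp (Primrec.tableMul ht (Primrec.tableMul ht hi hj) Primrec.snd)
      (Primrec.tableMul ht hi (Primrec.tableMul ht hj Primrec.snd))

/-! ### Decidability -/

theorem ComputablePred.and {α : Type} [Primcodable α] {p q : α → Prop} (hp : ComputablePred p)
    (hq : ComputablePred q) : ComputablePred fun a => p a ∧ q a := by
  classical
  obtain ⟨f, hf, rfl⟩ := ComputablePred.computable_iff.1 hp
  obtain ⟨g, hg, rfl⟩ := ComputablePred.computable_iff.1 hq
  exact ComputablePred.computable_iff.2 ⟨fun a => f a && g a,
    Primrec.and.to_comp.comp hf hg, by funext a; simp⟩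

theorem ComputablePred.forall_lt {α : Type} [Primcodable α] {p : α × ℕ → Prop} {f : α → ℕ}
    (hp : ComputablePred p) (hf : Computable f) :
    ComputablePred fun a => ∀ i < f a, p (a, i) := by
  obtain ⟨g, hg, rfl⟩ := ComputablePred.computable_iff.1 hp
  refine ComputablePred.computable_iff.2 ⟨fun a =>
    Nat.rec (motive := fun _ => Bool) true (fun i b => b && g (a, i)) (f a), ?_, ?_⟩
  · exact Computable.nat_rec (h := fun a (x : ℕ × Bool) => x.2 && g (a, x.1)) hf
      (Computable.const true) (Primrec.and.to_comp.comp (Computable.snd.comp Computable.snd)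
        (hg.comp (Computable.fst.pair (Computable.fst.comp Computable.snd))))
  · funext a
    simp only [eq_iff_iff]
    induction f a with
    | zero => simp
    | succ n ih => rw [Nat.forall_lt_succ_right, ih, Bool.and_eq_true]

theorem ComputablePred.comp {α β : Type} [Primcodable α] [Primcodable β] {p : β → Prop}
    {f : α → β} (hp : ComputablePred p) (hf : Computable f) : ComputablePred fun a => p (f a) := by
  obtain ⟨g, hg, rfl⟩ := ComputablePred.computable_iff.1 hp
  exact ComputablePred.computable_iff.2 ⟨fun a => g (f a), hg.comp hf, rfl⟩

theorem decidableMembership_classJ : DecidableMembership ClassJ := by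
  have hr : ∀ {α : Type} [Primcodable α] {t : α → List (List ℕ)}, Primrec t →
      Primrec fun a => List.range (t a).length := fun ht =>
    Primrec.list_range.comp (Primrec.list_length.comp ht)
  -- `i` lies in the two-sided ideal generated by `j`; `𝒥`-triviality is antisymmetry of this
  -- relation.
  let D : List (List ℕ) → ℕ → ℕ → Prop := fun t i j =>
    ∃ a ∈ List.range t.length, ∃ b ∈ List.range t.length, i = tableMul t (tableMul t a j) b
  have hD : ∀ {α : Type} [Primcodable α] {t : α → List (List ℕ)} {i j : α → ℕ}, Primrec t →
      Primrec i → Primrec j → PrimrecPred fun a => D (t a) (i a) (j a) := by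
    intro α _ t i j ht hi hj
    refine PrimrecPred.bex (hr ht) (PrimrecPred.bex (hr (ht.comp Primrec.fst)) ?_)
    have ht' := ht.comp (Primrec.fst.comp Primrec.fst : Primrec fun x : (α × ℕ) × ℕ => x.1.1)
    exact Primrec.eq.comp (hi.comp (Primrec.fst.comp Primrec.fst)) (Primrec.tableMul ht'
      (Primrec.tableMul ht' (Primrec.snd.comp Primrec.fst)
        (hj.comp (Primrec.fst.comp Primrec.fst))) Primrec.snd)
  have hP : PrimrecPred fun t => IsMonoidTable t ∧ ∀ i ∈ List.range t.length,
      ∀ j ∈ List.range t.length, D t i j → D t j i → i = j := by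
    refine PrimrecPred.isMonoidTable.and (PrimrecPred.ball (hr Primrec.id)
      (PrimrecPred.ball (hr Primrec.fst) ?_))
    have ht := (Primrec.fst.comp Primrec.fst : Primrec fun x : (List (List ℕ) × ℕ) × ℕ => x.1.1)
    have hi := (Primrec.snd.comp Primrec.fst : Primrec fun x : (List (List ℕ) × ℕ) × ℕ => x.1.2)
    exact (hD ht hi Primrec.snd).imp ((hD ht Primrec.snd hi).imp (Primrec.eq.comp hi Primrec.snd))
  refine hP.computablePred.of_eq fun t => ?_
  have key : ∀ (M : Type) [Monoid M], IsMulTable t M → ((∀ i ∈ List.range t.length,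
      ∀ j ∈ List.range t.length, D t i j → D t j i → i = j) ↔ ClassJ M) := by
    intro M _ hM
    obtain ⟨-, e, he⟩ := hM
    have hsurj : ∀ i ∈ List.range t.length, ∃ x, (e x : ℕ) = i := fun i hi => by
      obtain ⟨x, hx⟩ := e.surjective ⟨i, List.mem_range.1 hi⟩
      exact ⟨x, congrArg Fin.val hx⟩
    have hr : ∀ x, (e x : ℕ) ∈ List.range t.length := fun x => List.mem_range.2 (e x).2
    have hinj : ∀ x y, (e x : ℕ) = e y ↔ x = y := fun x y =>
      ⟨fun h => e.injective (Fin.ext h), fun h => by rw [h]⟩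
    have hDe : ∀ x y, D t (e x) (e y) ↔ ∃ a b : M, x = a * y * b := by
      intro x y
      constructor
      · rintro ⟨a, ha, b, hb, h⟩
        obtain ⟨a, rfl⟩ := hsurj a ha
        obtain ⟨b, rfl⟩ := hsurj b hb
        rw [tableMul_eq he, tableMul_eq he, hinj] at h
        exact ⟨a, b, h⟩
      · rintro ⟨a, b, h⟩
        exact ⟨e a, hr a, e b, hr b, by rw [tableMul_eq he, tableMul_eq he, hinj, h]⟩
    have : Finite M := Finite.of_equiv _ e.symm
    constructor
    · intro h
      refine ClassJ.of_eq_of_mul fun s r a b c d hs hr' => (hinj s r).1 ?_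
      exact h _ (hr s) _ (hr r) ((hDe _ _).2 ⟨a, b, hs⟩) ((hDe _ _).2 ⟨c, d, hr'⟩)
    · intro h i hi j hj hij hji
      obtain ⟨x, rfl⟩ := hsurj i hi
      obtain ⟨y, rfl⟩ := hsurj j hj
      obtain ⟨a, b, h1⟩ := (hDe _ _).1 hij
      obtain ⟨c, d, h2⟩ := (hDe _ _).1 hji
      rw [h.eq_of_mul h1 h2]
  constructor
  · rintro ⟨ht, h⟩
    obtain ⟨M, _, hM⟩ := ht.exists_isMulTable
    exact ⟨M, _, hM, (key M hM).1 h⟩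
  · rintro ⟨M, _, hM, h⟩
    exact ⟨hM.isMonoidTable, (key M hM).2 h⟩

/-- The case distinction on whether `V` has a nontrivial member need not be effective, since only
the existence of an algorithm for each fixed `V` is claimed. In the nontrivial case the given
algorithm for `V` is run on the tables of all base monoids. -/
theorem decidableMembership_twoSidedProduct {V : MonoidClass} (hV : IsPseudovariety V)
    (hdec : DecidableMembership V) : DecidableMembership (TwoSidedProduct V ClassJ) := by
  by_cases hG : ∃ (G : Type) (_ : Monoid G), V G ∧ Nontrivial G
  · obtain ⟨G, _, hVG, hG⟩ := hG
    have hP : ComputablePred fun t => IsMonoidTable t ∧ ∀ i < (kernelCode t).1,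
        ∃ (M : Type) (_ : Monoid M),
          IsMulTable (codeBaseTable (kernelCode (t, i).1) (t, i).2) M ∧ V M := by
      refine PrimrecPred.isMonoidTable.computablePred.and (ComputablePred.forall_lt
        (p := fun x : List (List ℕ) × ℕ => ∃ (M : Type) (_ : Monoid M),
          IsMulTable (codeBaseTable (kernelCode x.1) x.2) M ∧ V M) ?_
        (Primrec.fst.comp Primrec.kernelCode).to_comp)
      exact hdec.comp (Primrec.codeBaseTable.comp (Primrec.kernelCode.comp Primrec.fst)
        Primrec.snd).to_comp
    refine hP.of_eq fun t => ?_
    have key : ∀ (M : Type) [Monoid M], IsMulTable t M → ((∀ i < (kernelCode t).1,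
        ∃ (B : Type) (_ : Monoid B), IsMulTable (codeBaseTable (kernelCode t) i) B ∧ V B) ↔
        TwoSidedProduct V ClassJ M) := by
      intro M _ hM
      obtain ⟨o, a, ha, hm⟩ := isCategoryCode_kernelCode hM
      have : Finite M := Finite.of_equiv _ hM.2.choose.symm
      rw [twoSidedProduct_iff_baseMonoid hV hVG (FreeMonoid.lift (id : M → M))
        fun m => ⟨FreeMonoid.of m, by simp⟩]
      have hX := fun X => hV.mem_iff_of_isMulTable
        (IsCategoryCode.isMulTable_codeBaseTable o a ha hm X)
      constructor
      · exact fun h X => (hX X).1 (h (o X) (o X).2)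
      · intro h i hi
        obtain ⟨X, hXi⟩ := o.surjective ⟨i, hi⟩
        obtain rfl : (o X : ℕ) = i := congrArg Fin.val hXi
        exact (hX X).2 (h X)
    constructor
    · rintro ⟨ht, h⟩
      obtain ⟨M, _, hM⟩ := ht.exists_isMulTable
      exact ⟨M, _, hM, (key M hM).1 h⟩
    · rintro ⟨M, _, hM, h⟩
      exact ⟨hM.isMonoidTable, (key M hM).2 h⟩
  · have htriv : ∀ (G : Type) [Monoid G], V G → Subsingleton G := fun G _ h =>
      not_nontrivial_iff_subsingleton.1 fun hn => hG ⟨G, _, h, hn⟩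
    refine decidableMembership_classJ.of_eq fun t => ?_
    simp only [twoSidedProduct_iff_classJ hV htriv]

theorem mainTheorem4 :
    -- `V ** J` is a decidable pseudovariety if `V` is one
    (∀ V : MonoidClass, IsPseudovariety V → DecidableMembership V →
      IsPseudovariety (TwoSidedProduct V ClassJ) ∧
        DecidableMembership (TwoSidedProduct V ClassJ)) ∧
    -- the test on the base monoids of `ker_K φ` is correct
    (∀ V : MonoidClass, IsPseudovariety V →
      (∃ (G : Type) (_ : Monoid G), V G ∧ Nontrivial G) →
      ∀ (A M : Type) [Finite A] [Monoid M] [Finite M] (φ : FreeMonoid A →* M),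
        Function.Surjective φ →
        (TwoSidedProduct V ClassJ M ↔
          ∀ X : SubwordKernelCat (kernelBound A M) φ, V (BaseMonoid X))) ∧
    -- `ker_K φ` is computable from `M`, where `φ : M* → M` extends the identity map
    (∃ f : List (List ℕ) → CategoryCode, Computable f ∧
      ∀ (t : List (List ℕ)) (M : Type) [Monoid M], IsMulTable t M →
        IsCategoryCode (f t)
          (SubwordKernelCat (kernelBound M M) (FreeMonoid.lift (id : M → M)))) := by
  refine ⟨fun V hV hdec => ⟨TwoSidedProduct.isPseudovariety hV,
    decidableMembership_twoSidedProduct hV hdec⟩, ?_,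
    kernelCode, Primrec.kernelCode.to_comp, fun t M _ hM => isCategoryCode_kernelCode hM⟩
  rintro V hV ⟨G, _, hVG, hG⟩ A M _ _ _ φ hφ
  exact twoSidedProduct_iff_baseMonoid hV hVG φ hφ
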